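/- Let $n\ge 1$ and let $\mathcal G=(\mathcal I,E)$, $\mathcal I=\{1,\dots,N\}$, be a connected and acyclic (simple) graph, arbitrarily oriented, with incidence matrix $B\in\mathbb R^{N\times M}$ ($+1$ at the head, $-1$ at the tail of each edge), $M=|E|$, and let $\bar B=B^\top\otimes I_n$. To each edge $j\in E$ attach a spring with constant stiffness $k_j>0$ and rest length $r_j\ge 0$, and a damper with symmetric positive definite matrix $D^{\rm c}_j\in\mathbb R^{n\times n}$; let $D^{\rm c}=\mathrm{diag}(D^{\rm c}_j)$, $h^{\rm s}_j(z_j)=\tfrac12k_j(\|z_j\|-r_j)^2$, and, for $(z;p)\in\mathbb R^{nM}\times\mathbb R^{nN}$, $$H(z,p)=\tfrac12\sum_{i\in\mathcal I}\|p_i\|^2+\sum_{j\in E}h^{\rm s}_j(z_j).$$ For a collective vector $\boldsymbol x=(q;\dot q)$ with $x_i=(q_i,\dot q_i)\in\mathbb R^{2n}$ put $\boldsymbol x_{\rm pH}=(z;p)=(\bar Bq;\dot q)$. Let $\boldsymbol x(t)=(q(t);\dot q(t))$, $t\ge 0$, be a motion of the agents ($\dot q$ is the derivative of $q$) whose port-Hamiltonian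 state is a classical solution on $[0,\infty)$ of the collective dynamics $$\dot{\boldsymbol x}_{\rm pH}=-K\,\nabla H(\boldsymbol x_{\rm pH}),\qquad K=\begin{pmatrix}0&-\bar B\\ \bar B^\top&\bar B^\top D^{\rm c}\bar B\end{pmatrix}$$ (in particular $H$ is differentiable at $\boldsymbol x_{\rm pH}(t)$ for all $t\ge 0$). Let $\mathcal X_i\subset\mathbb R^{2n}$ be compact convex sets, and let $\Gamma=(\mathcal I,\{J_i\},\{\mathcal X_i\})$ be the game in which player $i$ minimises $$J_i(\boldsymbol x)=\tfrac12\|\dot q_i\|^2+\sum_{\ell\in\mathcal L_i}h^{\rm s}_\ell(z_\ell),\qquad z=\bar Bq,$$ over $x_i\in\mathcal X_i$, where $\mathcal L_i$ is the set of edges incident to $i$. Then: 1. $\Gamma$ is an exact potential game with potential $\boldsymbol x\mapsto H(\boldsymbol x_{\rm pH})$. 2. If the strategies are feasible along the motion, i.e. $x_i(t)\in\mathcal X_i$ for all $i\in\mathcal I$ and $t\ge0$, then $\boldsymbol x(t)$ converges, as $t\to\infty$, to a Nash equilibrium $\bar{\boldsymbol x}$ of $\Gamma$. At $\bar{\boldsymbol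 x}$ every spring is at its rest length ($\|\bar z_j\|=r_j$ for all $j\in E$), and $\bar{\boldsymbol x}_{\rm pH}$ is a global minimum point of $H$. 3. Independently of any feasibility assumption, if the total initial momentum $\sum_{i}\dot q_i(0)$ is zero, then $\boldsymbol x(t)$ converges to a point $\bar{\boldsymbol x}$ at which every spring is at its rest length and $H$ attains its global minimum, and $\bar{\boldsymbol x}$ is a Nash equilibrium of the game with the objectives $J_i$ and any feasible sets $\mathcal Y_i$ (compact, convex or not) with $\bar x_i\in\mathcal Y_i$ for all $i$. -/

import Mathlib

open Filter Topology
open scoped Kronecker Matrix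

/-! ### Games -/

/-- A game with player set `I` in which every player `i` chooses a variable in `Y`: the objective
functions `J i` (to be minimised) and the feasible sets `X i`. -/
structure Game (I Y : Type*) where
  /-- objective functions -/
  J : I → (I → Y) → ℝ
  /-- feasible sets -/
  X : I → Set Y

namespace Game

variable {I Y : Type*} [DecidableEq I]

/-- Nash equilibrium: a feasible profile at which no player can lower its own objective by a
feasible unilateral deviation. `Function.update x i y` is the profile `(y, x₋ᵢ)`. -/
def IsNashEquilibrium (Γ : Game I Y) (x : I → Y) : Prop :=
  (∀ i, x i ∈ Γ.X i) ∧ ∀ i, ∀ y ∈ Γ.X i, Γ.J i x ≤ Γ.J i (Function.update x i y)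

/-- `P` is an exact potential of the game: the variation of a player's objective under a
unilateral change of strategy is the variation of `P`. -/
def IsExactPotential (Γ : Game I Y) (P : (I → Y) → ℝ) : Prop :=
  ∀ x : I → Y, (∀ j, x j ∈ Γ.X j) → ∀ i, ∀ y ∈ Γ.X i, ∀ y' ∈ Γ.X i,
    Γ.J i (Function.update x i y) - Γ.J i (Function.update x i y') =
      P (Function.update x i y) - P (Function.update x i y')

end Game

/-! ### The network of agents and its virtual couplings -/

/-- An arbitrary orientation of a simple graph: every edge gets a tail and a head. -/
structure EdgeOrientation {V : Type*} (G : SimpleGraph V) where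
  tail : G.edgeSet → V
  head : G.edgeSet → V
  mk_tail_head : ∀ e, s(tail e, head e) = (e : Sym2 V)

/-- Virtual couplings: a spring (stiffness `k > 0`, rest length `r ≥ 0`) in parallel with a damper
(symmetric positive definite matrix `D`) for every edge. -/
structure VirtualCouplings (E : Type*) (n : ℕ) where
  k : E → ℝ
  r : E → ℝ
  D : E → Matrix (Fin n) (Fin n) ℝ
  k_pos : ∀ e, 0 < k e
  r_nonneg : ∀ e, 0 ≤ r e
  D_posDef : ∀ e, (D e).PosDef

namespace VirtualCouplings

variable {E : Type*} {n : ℕ}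

/-- Elastic potential `½ k (‖z‖ - r)²` of the spring on the edge `e`. -/
noncomputable def springEnergy (c : VirtualCouplings E n) (e : E)
    (z : EuclideanSpace ℝ (Fin n)) : ℝ :=
  1 / 2 * c.k e * (‖z‖ - c.r e) ^ 2

/-- The block diagonal matrix of the damping matrices of the edges. -/
def damping [DecidableEq E] (c : VirtualCouplings E n) :
    Matrix (E × Fin n) (E × Fin n) ℝ :=
  Matrix.of fun a b => if a.1 = b.1 then c.D a.1 a.2 b.2 else 0

end VirtualCouplings

section Network

variable {V : Type*} [Fintype V] [DecidableEq V] {G : SimpleGraph V} [DecidableRel G.Adj]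

/-- The incidence matrix `B`: `+1` at the head and `-1` at the tail of each edge. -/
def EdgeOrientation.incidence (o : EdgeOrientation G) : Matrix V G.edgeSet ℝ :=
  Matrix.of fun i e => if i = o.head e then 1 else if i = o.tail e then -1 else 0

/-- `B̄ = Bᵀ ⊗ Iₙ`. -/
def EdgeOrientation.barB (o : EdgeOrientation G) (n : ℕ) :
    Matrix (G.edgeSet × Fin n) (V × Fin n) ℝ :=
  o.incidenceᵀ ⊗ₖ (1 : Matrix (Fin n) (Fin n) ℝ)

/-- The port-Hamiltonian state space of the pairs `(z; p)`. -/
abbrev PHState (G : SimpleGraph V) [DecidableRel G.Adj] (n : ℕ) : Type _ :=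
  EuclideanSpace ℝ ((G.edgeSet × Fin n) ⊕ (V × Fin n))

/-- The block `z_e` of a state `(z; p)`. -/
def PHState.z {n : ℕ} (ξ : PHState G n) (e : G.edgeSet) : EuclideanSpace ℝ (Fin n) :=
  WithLp.toLp 2 fun a => ξ (Sum.inl (e, a))

/-- The block `p_i` of a state `(z; p)`. -/
def PHState.p {n : ℕ} (ξ : PHState G n) (i : V) : EuclideanSpace ℝ (Fin n) :=
  WithLp.toLp 2 fun a => ξ (Sum.inr (i, a))

/-- The Hamiltonian `H(z, p) = ∑ᵢ ½ pᵢᵀ pᵢ + ∑ₑ ½ kₑ (‖zₑ‖ - rₑ)²`. -/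
noncomputable def hamiltonian {n : ℕ} (c : VirtualCouplings G.edgeSet n) (ξ : PHState G n) : ℝ :=
  ∑ i, 1 / 2 * ‖PHState.p ξ i‖ ^ 2 + ∑ e, c.springEnergy e (PHState.z ξ e)

/-- The matrix `K = [[0, -B̄], [B̄ᵀ, B̄ᵀ Dᶜ B̄]]`. -/
def collectiveMatrix {n : ℕ} (o : EdgeOrientation G) (c : VirtualCouplings G.edgeSet n) :
    Matrix ((G.edgeSet × Fin n) ⊕ (V × Fin n)) ((G.edgeSet × Fin n) ⊕ (V × Fin n)) ℝ :=
  Matrix.fromBlocks 0 (-o.barB n) (o.barB n)ᵀ ((o.barB n)ᵀ * c.damping * o.barB n)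

/-- `ξ` is a classical solution on `[0, ∞)` of `ξ' = -K ∇H(ξ)`. The Hamiltonian is not
differentiable where `z_e = 0` for a spring of positive rest length; the equation has a meaning
only where the gradient exists, so this is part of solving it. -/
def IsCollectiveSolution {n : ℕ} (o : EdgeOrientation G) (c : VirtualCouplings G.edgeSet n)
    (ξ : ℝ → PHState G n) : Prop :=
  ∀ t, 0 ≤ t → ∃ g : PHState G n, HasGradientAt (hamiltonian c) g (ξ t) ∧
    HasDerivWithinAt ξ (WithLp.toLp 2 (-(collectiveMatrix o c *ᵥ g.ofLp))) (Set.Ici 0) t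

/-- The decision variable `x_i = (q_i, q̇_i)` of an agent. -/
abbrev AgentVar (n : ℕ) : Type :=
  EuclideanSpace ℝ (Fin n) × EuclideanSpace ℝ (Fin n)

/-- The port-Hamiltonian state `(B̄ q; q̇)` of the collective vector `x = (q; q̇)`. -/
noncomputable def toPHState {n : ℕ} (o : EdgeOrientation G) (x : V → AgentVar n) : PHState G n :=
  WithLp.toLp 2 (Sum.elim (o.barB n *ᵥ fun b => (x b.1).1 b.2) fun b => (x b.1).2 b.2)

/-- A motion of the agents: the second component of `x_i` is the velocity of the first one, and
the port-Hamiltonian state of `x` solves the collective dynamics. -/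
def IsAgentTrajectory {n : ℕ} (o : EdgeOrientation G) (c : VirtualCouplings G.edgeSet n)
    (x : ℝ → V → AgentVar n) : Prop :=
  (∀ t, 0 ≤ t → ∀ i, HasDerivWithinAt (fun s => (x s i).1) (x t i).2 (Set.Ici 0) t) ∧
    IsCollectiveSolution o c fun t => toPHState o (x t)

/-- The game of the network: player `i` minimises its own kinetic energy plus the elastic
energies of the edges `e` with `b_{i,e} ≠ 0`. -/
noncomputable def networkGame {n : ℕ} (o : EdgeOrientation G) (c : VirtualCouplings G.edgeSet n)
    (X : V → Set (AgentVar n)) : Game V (AgentVar n) where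
  J i x := 1 / 2 * ‖(x i).2‖ ^ 2 +
    ∑ e with o.incidence i e ≠ 0, c.springEnergy e (PHState.z (toPHState o x) e)
  X := X

end Network

/-! The dynamics is moved to the edges. Acyclicity makes `B` injective, so `a = BᵀB` is positive
definite, and `z = Bᵀq`, `m = a⁻¹Bᵀp` satisfy `ż = a m`, `ṁ = -(f(z) + D a m)`, where `f` is the
gradient of the elastic energy (`IsAgentTrajectory.isSpringFlow`). The total momentum has dropped
out of this system.

The energy by itself dissipates only through the velocities `a m`. A small multiple of `∑ ⟪m,
ψ(z)⟫`, with the polynomial field `ψ(z) = (‖z‖² - r²) z` (`ψ(z) = z` if `r = 0`), is added; the new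
function also dissipates `⟪f, ψ⟫` (`IsSpringFlow.exists_lyapunov`). Barbalat's argument gives `m →
0` and `ψ(z) → 0`, so every `‖z_e‖` tends to `r_e` or to `0`.

The crux is to exclude a collapse to `0` when `r_e > 0` (`IsSpringFlow.not_tendsto_norm_zero`). Near
the origin the spring pushes outwards with a force of size about `k r`, so a suitable quadratic form
`u` of all the collapsing elongations satisfies `u'' ≥ c √u`. As `u` and `u'` tend to `0`, `u` would
vanish in finite time, whereas differentiability of `H` keeps `z_e ≠ 0`.

Once `‖z_e‖ → r_e`, the dissipation controls the energy and `m` decays exponentially. The rate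
matters: the rest configurations form a continuum, so `‖z_e‖ → r_e` alone does not make the
positions converge. If the total momentum is zero, connectedness gives `p = B m`, the velocities are
integrable and `q` converges. Along a feasible motion the momentum must be zero, since the
barycentre moves uniformly and stays bounded.

In the limit the velocities vanish and the springs are at rest, so `H` and all the `J_i`, which are
nonnegative, are zero: the limit is a Nash equilibrium. The potential property holds because `H -
J_i` does not involve `x_i`. -/

/-! ### Matrices acting on families of vectors -/

section MixVec

open scoped RealInnerProductSpace

variable {ι κ μ W : Type*} [Fintype ι] [Fintype κ] [Fintype μ]
  [NormedAddCommGroup W] [InnerProductSpace ℝ W]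

/-- The action of a real matrix on a family of vectors, that is, of `a ⊗ 1`. -/
def mixVec (a : Matrix ι κ ℝ) (m : κ → W) (i : ι) : W := ∑ j, a i j • m j

omit [Fintype ι] in
theorem mixVec_mul (a : Matrix ι κ ℝ) (b : Matrix κ μ ℝ) (m : μ → W) (i : ι) :
    mixVec (a * b) m i = mixVec a (mixVec b m) i := by
  simp only [mixVec, Matrix.mul_apply, Finset.sum_smul, Finset.smul_sum, mul_smul]
  exact Finset.sum_comm

theorem mixVec_one [DecidableEq ι] (m : ι → W) (i : ι) :
    mixVec (1 : Matrix ι ι ℝ) m i = m i := by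
  simp [mixVec, Matrix.one_apply]

theorem sum_inner_mixVec (a : Matrix ι κ ℝ) (x : ι → W) (y : κ → W) :
    ∑ i, ⟪x i, mixVec a y i⟫ = ∑ j, ⟪mixVec aᵀ x j, y j⟫ := by
  simp only [mixVec, inner_sum, sum_inner, inner_smul_left, inner_smul_right,
    Matrix.transpose_apply]
  exact Finset.sum_comm

theorem exists_norm_mixVec_le (a : Matrix ι κ ℝ) :
    ∃ C > 0, ∀ m : κ → W, ∀ i, ‖mixVec a m i‖ ^ 2 ≤ C * ∑ j, ‖m j‖ ^ 2 := by
  refine ⟨1 + ∑ i, ∑ j, a i j ^ 2, by positivity, fun m i => ?_⟩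
  have h1 : ‖mixVec a m i‖ ≤ ∑ j, |a i j| * ‖m j‖ := by
    refine (norm_sum_le _ _).trans (le_of_eq ?_)
    simp [norm_smul]
  have h2 : (∑ j, |a i j| * ‖m j‖) ^ 2 ≤ (∑ j, a i j ^ 2) * ∑ j, ‖m j‖ ^ 2 := by
    simpa [sq_abs] using Finset.sum_mul_sq_le_sq_mul_sq Finset.univ (fun j => |a i j|)
      (fun j => ‖m j‖)
  have h3 : ∑ j, a i j ^ 2 ≤ ∑ i, ∑ j, a i j ^ 2 :=
    Finset.single_le_sum (f := fun i => ∑ j, a i j ^ 2) (fun i _ => by positivity)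
      (Finset.mem_univ i)
  have h4 : (0 : ℝ) ≤ ∑ j, ‖m j‖ ^ 2 := by positivity
  calc ‖mixVec a m i‖ ^ 2 ≤ (∑ j, |a i j| * ‖m j‖) ^ 2 := by gcongr
    _ ≤ _ := h2
    _ ≤ _ := by gcongr; linarith

open scoped MatrixOrder Matrix.Norms.L2Operator in
-- Writing `a = y* y` with `y` invertible, the form is `∑ ‖(y m)_i‖²`, and `m = y⁻¹ (y m)` is
-- bounded by it. This avoids eigenvalues and works for families in any inner product space.
theorem Matrix.PosDef.exists_coercive [DecidableEq ι] {a : Matrix ι ι ℝ} (ha : a.PosDef) :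
    ∃ l > 0, ∀ m : ι → W, l * ∑ i, ‖m i‖ ^ 2 ≤ ∑ i, ⟪m i, mixVec a m i⟫ := by
  obtain ⟨y, rfl⟩ := CStarAlgebra.nonneg_iff_eq_star_mul_self.mp ha.posSemidef.nonneg
  have hy : IsUnit y.det := by
    have h := (Matrix.isUnit_iff_isUnit_det _).mp ha.isUnit
    rw [Matrix.det_mul] at h
    exact isUnit_of_mul_isUnit_right h
  obtain ⟨C, hC, h⟩ := exists_norm_mixVec_le (W := W) y⁻¹
  have hn : 0 < ((Fintype.card ι : ℝ) + 1) * C := by positivity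
  refine ⟨(((Fintype.card ι : ℝ) + 1) * C)⁻¹, by positivity, fun m => ?_⟩
  have h1 : ∑ i, ⟪m i, mixVec (star y * y) m i⟫ = ∑ i, ‖mixVec y m i‖ ^ 2 := by
    simp only [mixVec_mul]
    rw [sum_inner_mixVec]
    simp [Matrix.star_eq_conjTranspose, Matrix.conjTranspose_eq_transpose_of_trivial]
  have h2 : ∀ i, ‖m i‖ ^ 2 ≤ C * ∑ j, ‖mixVec y m j‖ ^ 2 := fun i => by
    have := h (mixVec y m) i
    rwa [← mixVec_mul, Matrix.nonsing_inv_mul _ hy, mixVec_one] at this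
  have h3 : ∑ i, ‖m i‖ ^ 2 ≤ ((Fintype.card ι : ℝ) + 1) * C * ∑ j, ‖mixVec y m j‖ ^ 2 := by
    calc ∑ i, ‖m i‖ ^ 2 ≤ ∑ _i : ι, C * ∑ j, ‖mixVec y m j‖ ^ 2 :=
          Finset.sum_le_sum fun i _ => h2 i
      _ = (Fintype.card ι : ℝ) * (C * ∑ j, ‖mixVec y m j‖ ^ 2) := by simp
      _ ≤ ((Fintype.card ι : ℝ) + 1) * (C * ∑ j, ‖mixVec y m j‖ ^ 2) := by
          gcongr; linarith
      _ = _ := by ring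
  rw [h1, inv_mul_le_iff₀ hn]
  exact h3

omit [Fintype ι] in
theorem HasDerivAt.mixVec (a : Matrix ι κ ℝ) {m : ℝ → κ → W} {m' : κ → W} {t : ℝ}
    (h : ∀ j, HasDerivAt (fun s => m s j) (m' j) t) (i : ι) :
    HasDerivAt (fun s => mixVec a (m s) i) (mixVec a m' i) t :=
  HasDerivAt.fun_sum fun j _ => (h j).const_smul (a i j)

omit [Fintype ι] in
theorem Filter.Tendsto.mixVec {α : Type*} {l : Filter α} (a : Matrix ι κ ℝ) {m : α → κ → W}
    {m' : κ → W} (h : ∀ j, Tendsto (fun s => m s j) l (𝓝 (m' j))) (i : ι) :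
    Tendsto (fun s => mixVec a (m s) i) l (𝓝 (mixVec a m' i)) :=
  tendsto_finsetSum _ fun j _ => (h j).const_smul (a i j)

omit [Fintype ι] in
theorem mixVec_zero (a : Matrix ι κ ℝ) (i : ι) : mixVec a (fun _ => (0 : W)) i = 0 := by
  simp [mixVec]

end MixVec

/-! ### Scalar differential inequalities -/

theorem antitoneOn_Ici_of_hasDerivAt_nonpos {u u' : ℝ → ℝ} {T : ℝ}
    (h : ∀ t ≥ T, HasDerivAt u (u' t) t) (h' : ∀ t ≥ T, u' t ≤ 0) : AntitoneOn u (Set.Ici T) := by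
  refine antitoneOn_of_deriv_nonpos (convex_Ici T)
    (fun t ht => (h t ht).continuousAt.continuousWithinAt)
    (fun t ht => (h t (interior_subset ht)).differentiableAt.differentiableWithinAt)
    fun t ht => ?_
  rw [(h t (interior_subset ht)).deriv]
  exact h' t (interior_subset ht)

theorem nonneg_of_antitoneOn_of_tendsto {u : ℝ → ℝ} {T l : ℝ} (h : AntitoneOn u (Set.Ici T))
    (hl : Tendsto u atTop (𝓝 l)) {t : ℝ} (ht : T ≤ t) : l ≤ u t := by
  refine le_of_tendsto hl ?_
  filter_upwards [eventually_ge_atTop t] with s hs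
  exact h ht (ht.trans hs) hs

/-- A form of Barbalat's lemma. -/
theorem tendsto_zero_of_dissipation {U U' F F' : ℝ → ℝ} {T B L : ℝ}
    (hU : ∀ t ≥ T, HasDerivAt U (U' t) t) (hUF : ∀ t ≥ T, U' t ≤ -F t)
    (hB : ∀ t ≥ T, B ≤ U t) (hF0 : ∀ t ≥ T, 0 ≤ F t)
    (hF : ∀ t ≥ T, HasDerivAt F (F' t) t) (hL : ∀ t ≥ T, -L ≤ F' t) :
    Tendsto F atTop (𝓝 0) := by
  have hanti : AntitoneOn U (Set.Ici T) := antitoneOn_Ici_of_hasDerivAt_nonpos hU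
    fun t ht => (hUF t ht).trans (by linarith [hF0 t ht])
  -- `L` may be nonpositive, and the step length below divides by the slope bound.
  obtain ⟨L', hL', hLL⟩ : ∃ L' > 0, L ≤ L' := ⟨max L 1, by positivity, le_max_left _ _⟩
  -- Since `F` falls at a rate of at most `L'`, its integral over `[t, t + h]`, which bounds the
  -- loss of `U` from below, is at least the area under a line of slope `-L'`.
  have key : ∀ t ≥ T, ∀ h ≥ 0, F t * h - L' * h ^ 2 / 2 ≤ U t - U (t + h) := by
    intro t ht h hh
    have hFm : ∀ s ≥ t, F t - L' * (s - t) ≤ F s := by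
      intro s hs
      have := antitoneOn_Ici_of_hasDerivAt_nonpos (u := fun s => - F s - L' * s) (T := T)
        (u' := fun s => - F' s - L') (fun s hs => by
          simpa using (hF s hs).fun_neg.fun_sub ((hasDerivAt_id s).const_mul L'))
        (fun s hs => by linarith [hL s hs]) ht (ht.trans hs) hs
      simp only at this
      linarith
    have := antitoneOn_Ici_of_hasDerivAt_nonpos (T := t)
      (u := fun s => U s + (F t * (s - t) - L' * (s - t) ^ 2 / 2))
      (u' := fun s => U' s + (F t - L' * (s - t))) (fun s hs => by
        have h1 : HasDerivAt (fun s => s - t) 1 s := (hasDerivAt_id s).sub_const t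
        have h2 := (h1.const_mul (F t)).sub (((h1.pow 2).const_mul L').div_const 2)
        refine ((hU s (ht.trans hs)).add h2).congr_deriv ?_
        norm_num
        ring)
      (fun s hs => by linarith [hFm s hs, hUF s (ht.trans hs)])
      (Set.mem_Ici.2 le_rfl) (show t + h ∈ Set.Ici t by simpa using hh) (by linarith)
    simp only [sub_self, add_sub_cancel_left] at this
    linarith
  obtain ⟨l, hl⟩ : ∃ l, Tendsto U atTop (𝓝 l) := by
    have h1 : Antitone fun t => U (max t T) := fun s t hst =>
      hanti (Set.mem_Ici.2 (le_max_right _ _)) (Set.mem_Ici.2 (le_max_right _ _)) (max_le_max_right _ hst)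
    have h2 : BddBelow (Set.range fun t => U (max t T)) :=
      ⟨B, by rintro _ ⟨t, rfl⟩; exact hB _ (le_max_right _ _)⟩
    refine ⟨_, (tendsto_atTop_ciInf h1 h2).congr' ?_⟩
    filter_upwards [eventually_ge_atTop T] with t ht
    simp [ht]
  rw [Metric.tendsto_atTop]
  intro ε hε
  -- With this `h`, `F t ≥ ε` would force `U` to lose at least `ε * h / 2`, which is impossible for
  -- late times because `U` converges.
  set h := ε / L' with hdef
  have hh : 0 < h := by positivity
  have hlim : Tendsto (fun t => U t - U (t + h)) atTop (𝓝 (l - l)) :=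
    hl.sub (hl.comp (tendsto_atTop_add_const_right _ _ tendsto_id))
  rw [sub_self] at hlim
  have hev := hlim.eventually (gt_mem_nhds (show 0 < ε * h / 2 by positivity))
  obtain ⟨T₁, hT₁⟩ := eventually_atTop.1 (hev.and (eventually_ge_atTop T))
  refine ⟨T₁, fun t ht => ?_⟩
  obtain ⟨h1, h2⟩ := hT₁ t ht
  have h3 := key t h2 h hh.le
  have h4 : L' * h = ε := by rw [hdef]; field_simp
  rw [Real.dist_eq, sub_zero, abs_of_nonneg (hF0 t h2)]
  by_contra hcon
  push Not at hcon
  have h5 : ε * h ≤ F t * h := by gcongr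
  nlinarith

theorem exp_decay_of_deriv_le {U U' : ℝ → ℝ} {T c : ℝ}
    (hU : ∀ t ≥ T, HasDerivAt U (U' t) t) (h : ∀ t ≥ T, U' t ≤ -(c * U t)) :
    ∀ t ≥ T, U t ≤ U T * Real.exp (-(c * (t - T))) := by
  intro t ht
  have := antitoneOn_Ici_of_hasDerivAt_nonpos (T := T)
    (u := fun s => U s * Real.exp (c * (s - T)))
    (u' := fun s => U' s * Real.exp (c * (s - T)) + U s * (Real.exp (c * (s - T)) * c))
    (fun s hs => by
      have h1 : HasDerivAt (fun s => c * (s - T)) c s := by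
        simpa using ((hasDerivAt_id s).sub_const T).const_mul c
      exact (hU s hs).mul h1.exp)
    (fun s hs => by
      have := h s hs
      have he := Real.exp_pos (c * (s - T))
      nlinarith)
    (Set.mem_Ici.2 le_rfl) ht ht
  simp only [sub_self, mul_zero, Real.exp_zero, mul_one] at this
  rw [Real.exp_neg, ← div_eq_mul_inv, le_div_iff₀ (Real.exp_pos _)]
  exact this

/-- A positive function cannot tend to zero together with its derivative when its second
derivative is at least a multiple of its square root: it would vanish in finite time. -/
theorem not_tendsto_zero_of_sqrt_le_deriv_deriv {u u₁ u₂ : ℝ → ℝ} {T c : ℝ} (hc : 0 < c)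
    (hu : ∀ t ≥ T, HasDerivAt u (u₁ t) t) (hu₁ : ∀ t ≥ T, HasDerivAt u₁ (u₂ t) t)
    (hpos : ∀ t ≥ T, 0 < u t) (hu₂ : ∀ t ≥ T, c * √(u t) ≤ u₂ t)
    (h0 : Tendsto u atTop (𝓝 0)) (h1 : Tendsto u₁ atTop (𝓝 0)) : False := by
  have hneg : ∀ t ≥ T, u₁ t ≤ 0 := by
    have hanti : AntitoneOn (fun t => - u₁ t) (Set.Ici T) :=
      antitoneOn_Ici_of_hasDerivAt_nonpos (fun t ht => (hu₁ t ht).neg) fun t ht => by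
        have := hu₂ t ht
        have : 0 ≤ c * √(u t) := by positivity
        linarith
    intro t ht
    have := nonneg_of_antitoneOn_of_tendsto hanti (l := 0) (by simpa using h1.neg) ht
    linarith
  -- the square root `g` of `u`
  have hg : ∀ t ≥ T, HasDerivAt (fun s => √(u s)) (u₁ t / (2 * √(u t))) t := fun t ht =>
    (hu t ht).sqrt (hpos t ht).ne'
  have hgpos : ∀ t ≥ T, 0 < √(u t) := fun t ht => Real.sqrt_pos.2 (hpos t ht)
  have hg0 : Tendsto (fun t => √(u t)) atTop (𝓝 0) := by simpa using h0.sqrt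
  -- Multiplying `u'' ≥ c √u` by `2 u' ≤ 0` shows that `u'² - (4c/3) u^(3/2)` is nonincreasing; its
  -- limit is `0`, so it is nonnegative.
  have henergy : ∀ t ≥ T, 4 * c / 3 * √(u t) ^ 3 ≤ u₁ t ^ 2 := by
    have hanti : AntitoneOn (fun t => u₁ t ^ 2 - 4 * c / 3 * √(u t) ^ 3) (Set.Ici T) := by
      refine antitoneOn_Ici_of_hasDerivAt_nonpos
        (u' := fun t => 2 * u₁ t * (u₂ t - c * √(u t))) (fun t ht => ?_) fun t ht => ?_
      · have h2 := ((hu₁ t ht).pow 2).sub (((hg t ht).pow 3).const_mul (4 * c / 3))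
        refine h2.congr_deriv ?_
        have h3 := (hgpos t ht).ne'
        norm_num
        field_simp
        ring
      · have := hneg t ht
        have := hu₂ t ht
        nlinarith
    intro t ht
    have := nonneg_of_antitoneOn_of_tendsto hanti (l := 0)
      (by simpa using (h1.pow 2).sub ((hg0.pow 3).const_mul (4 * c / 3))) ht
    linarith
  obtain ⟨d, hd, hdc⟩ : ∃ d > 0, d ^ 2 = 4 * c / 3 :=
    ⟨√(4 * c / 3), by positivity, Real.sq_sqrt (by positivity)⟩
  have hw : ∀ t ≥ T, HasDerivAt (fun s => √√(u s)) (u₁ t / (2 * √(u t)) / (2 * √√(u t))) t :=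
    fun t ht => (hg t ht).sqrt (hgpos t ht).ne'
  -- The energy inequality reads `-u' ≥ d u^(3/4)`, so `u^(1/4)` decreases at a rate of at least `d
  -- / 4`, which cannot last forever.
  have hanti : AntitoneOn (fun t => √√(u t) + d / 4 * t) (Set.Ici T) := by
    refine antitoneOn_Ici_of_hasDerivAt_nonpos (fun t ht => (hw t ht).add
      ((hasDerivAt_id t).const_mul (d / 4))) fun t ht => ?_
    set g := √(u t)
    have hg := hgpos t ht
    set w := √g
    have hwp : 0 < w := Real.sqrt_pos.2 hg
    have hwg : w ^ 2 = g := Real.sq_sqrt hg.le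
    have h3 : d * w ^ 3 ≤ - u₁ t := by
      refine abs_le_of_sq_le_sq' ?_ (by linarith [hneg t ht]) |>.2
      have := henergy t ht
      change 4 * c / 3 * g ^ 3 ≤ _ at this
      rw [← hdc, ← hwg] at this
      nlinarith
    rw [← hwg]
    have h4 : u₁ t / (2 * w ^ 2) / (2 * w) ≤ - (d / 4) := by
      rw [div_div, div_le_iff₀ (by positivity)]
      nlinarith
    linarith
  have hlim : Tendsto (fun t => √√(u t) + d / 4 * t) atTop atTop :=
    tendsto_atTop_mono (fun t => le_add_of_nonneg_left (Real.sqrt_nonneg _))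
      (tendsto_id.const_mul_atTop (by positivity : 0 < d / 4))
  obtain ⟨t, ht, h2⟩ := ((hlim.eventually_gt_atTop (√√(u T) + d / 4 * T)).and
    (eventually_ge_atTop T)).exists
  have := hanti (Set.mem_Ici.2 le_rfl) h2 h2
  simp only at this
  linarith

/-- A continuous nonnegative function `ρ` with `ρ (ρ² - r²) → 0` converges, to `0` or to `r`. -/
theorem tendsto_zero_or_of_tendsto_mul {ρ : ℝ → ℝ} {r T : ℝ} (hr : 0 < r)
    (hρ : ∀ t ≥ T, 0 ≤ ρ t) (hcont : ContinuousOn ρ (Set.Ici T))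
    (h : Tendsto (fun t => ρ t * (ρ t ^ 2 - r ^ 2)) atTop (𝓝 0)) :
    Tendsto ρ atTop (𝓝 0) ∨ Tendsto ρ atTop (𝓝 r) := by
  have h' := h.abs
  rw [abs_zero] at h'
  obtain ⟨T₁, hT₁⟩ := eventually_atTop.1 ((h'.eventually (gt_mem_nhds
    (show 0 < 3 * r ^ 3 / 8 by positivity))).and (eventually_ge_atTop T))
  -- At `ρ = r / 2` the product has absolute value `3 r³ / 8`. So `ρ` eventually avoids this level
  -- and, by continuity, stays on one side of it; there, one factor of the product is at least `3 r²
  -- / 4` in absolute value.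
  have hne : ∀ t ≥ T₁, ρ t ≠ r / 2 := by
    intro t ht heq
    have h1 := (hT₁ t ht).1
    rw [heq, show r / 2 * ((r / 2) ^ 2 - r ^ 2) = - (3 * r ^ 3 / 8) by ring, abs_neg,
      abs_of_pos (by positivity)] at h1
    exact lt_irrefl _ h1
  have hconn : IsPreconnected (ρ '' Set.Ici T₁) :=
    isPreconnected_Ici.image _ (hcont.mono (Set.Ici_subset_Ici.2 (hT₁ T₁ le_rfl).2))
  rcases lt_or_gt_of_ne (hne T₁ le_rfl) with hlt | hgt
  · left
    have hall : ∀ t ≥ T₁, ρ t < r / 2 := by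
      intro t ht
      by_contra hcon
      obtain ⟨s, hs, hs'⟩ := hconn.ordConnected.out ⟨T₁, Set.self_mem_Ici, rfl⟩ ⟨t, ht, rfl⟩
        ⟨hlt.le, not_lt.1 hcon⟩
      exact hne s hs hs'
    refine squeeze_zero_norm' (a := fun t => (3 * r ^ 2 / 4)⁻¹ * |ρ t * (ρ t ^ 2 - r ^ 2)|) ?_
      (by simpa using h'.const_mul _)
    filter_upwards [eventually_ge_atTop T₁] with t ht
    have h0 := hρ t (hT₁ t ht).2
    have h1 := hall t ht
    rw [Real.norm_of_nonneg h0, le_inv_mul_iff₀ (by positivity), abs_mul, abs_of_nonneg h0,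
      mul_comm]
    refine mul_le_mul_of_nonneg_left ?_ h0
    rw [abs_sub_comm]
    refine le_trans ?_ (le_abs_self _)
    nlinarith
  · right
    have hall : ∀ t ≥ T₁, r / 2 < ρ t := by
      intro t ht
      by_contra hcon
      obtain ⟨s, hs, hs'⟩ := hconn.ordConnected.out ⟨t, ht, rfl⟩ ⟨T₁, Set.self_mem_Ici, rfl⟩
        ⟨not_lt.1 hcon, hgt.le⟩
      exact hne s hs hs'
    rw [← tendsto_sub_nhds_zero_iff]
    refine squeeze_zero_norm' (a := fun t => (3 * r ^ 2 / 4)⁻¹ * |ρ t * (ρ t ^ 2 - r ^ 2)|) ?_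
      (by simpa using h'.const_mul _)
    filter_upwards [eventually_ge_atTop T₁] with t ht
    have h1 := hall t ht
    rw [le_inv_mul_iff₀ (by positivity), Real.norm_eq_abs,
      show ρ t * (ρ t ^ 2 - r ^ 2) = ρ t * (ρ t + r) * (ρ t - r) by ring, abs_mul _ (ρ t - r)]
    refine mul_le_mul_of_nonneg_right ?_ (abs_nonneg _)
    refine le_trans ?_ (le_abs_self _)
    nlinarith

/-! ### A single spring -/

section Spring

open scoped RealInnerProductSpace

variable {W : Type*} [NormedAddCommGroup W] [InnerProductSpace ℝ W]

/-- Elastic energy of a spring of stiffness `k` and rest length `r`. -/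
noncomputable def elasticEnergy (k r : ℝ) (z : W) : ℝ := 1 / 2 * k * (‖z‖ - r) ^ 2

/-- Elastic force: the gradient of the elastic energy, wherever it exists. -/
noncomputable def elasticForce (k r : ℝ) (z : W) : W := (k * (1 - r / ‖z‖)) • z

/-- A polynomial vector field with the zeros of the elastic force, and the origin. -/
noncomputable def elasticMultiplier (r : ℝ) (z : W) : W :=
  (if r = 0 then 1 else ‖z‖ ^ 2 - r ^ 2) • z

/-- The derivative of the elastic multiplier at `z` in the direction `v`. -/
noncomputable def elasticMultiplierDeriv (r : ℝ) (z v : W) : W :=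
  if r = 0 then v else (2 * ⟪z, v⟫) • z + (‖z‖ ^ 2 - r ^ 2) • v

variable {k r : ℝ}

omit [InnerProductSpace ℝ W] in
theorem elasticEnergy_nonneg (hk : 0 < k) (z : W) : 0 ≤ elasticEnergy k r z := by
  unfold elasticEnergy; positivity

theorem inner_elasticForce_self {z : W} : ⟪elasticForce k r z, z⟫ = k * ‖z‖ * (‖z‖ - r) := by
  rw [elasticForce, real_inner_smul_left, real_inner_self_eq_norm_sq]
  by_cases hz : z = 0
  · simp [hz]
  · have : ‖z‖ ≠ 0 := norm_ne_zero_iff.2 hz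
    field_simp

/-- The force is bounded on bounded sets although it is discontinuous at the origin when `r > 0`;
its value at the origin is `0`. -/
theorem norm_elasticForce_le (hk : 0 < k) (z : W) :
    ‖elasticForce k r z‖ ≤ k * |‖z‖ - r| := by
  rw [elasticForce, norm_smul, Real.norm_eq_abs, abs_mul, abs_of_pos hk, mul_assoc]
  refine mul_le_mul_of_nonneg_left ?_ hk.le
  by_cases hz : z = 0
  · simp [hz]
  · have : 0 < ‖z‖ := norm_pos_iff.2 hz
    refine le_of_eq ?_
    rw [← abs_of_pos this, ← abs_mul, abs_of_pos this]
    congr 1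
    field_simp

/-- For `r = 0` the energy is `½ k ‖z‖²`, which is smooth at the origin too. -/
theorem HasDerivAt.elasticEnergy {z : ℝ → W} {v : W} {t : ℝ} (hz : HasDerivAt z v t)
    (h : z t ≠ 0 ∨ r = 0) :
    HasDerivAt (fun s => elasticEnergy k r (z s)) ⟪elasticForce k r (z t), v⟫ t := by
  by_cases hr : r = 0
  · subst hr
    have := hz.norm_sq.const_mul (1 / 2 * k)
    refine (this.congr_of_eventuallyEq (Eventually.of_forall fun s => ?_)).congr_deriv ?_
    · simp [_root_.elasticEnergy]
    · simp only [elasticForce, zero_div, sub_zero, mul_one, real_inner_smul_left]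
      ring
  · have hne := h.resolve_right hr
    have hn : ‖z t‖ ≠ 0 := norm_ne_zero_iff.2 hne
    have h1 : HasDerivAt (fun s => ‖z s‖) (⟪z t, v⟫ / ‖z t‖) t := by
      have h2 := hz.norm_sq.sqrt (pow_ne_zero 2 hn)
      refine (h2.congr_of_eventuallyEq (Eventually.of_forall fun s => ?_)).congr_deriv ?_
      · simp
      · rw [Real.sqrt_sq (norm_nonneg _)]
        field_simp
    refine (((h1.sub_const r).pow 2).const_mul (1 / 2 * k)).congr_deriv ?_
    rw [elasticForce, real_inner_smul_left]
    norm_num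
    field_simp

theorem HasDerivAt.elasticMultiplier {z : ℝ → W} {v : W} {t : ℝ} (hz : HasDerivAt z v t) :
    HasDerivAt (fun s => elasticMultiplier r (z s)) (elasticMultiplierDeriv r (z t) v) t := by
  unfold _root_.elasticMultiplier elasticMultiplierDeriv
  split_ifs with h
  · simpa using hz
  · refine ((hz.norm_sq.sub_const (r ^ 2)).smul hz).congr_deriv ?_
    rw [add_comm]

theorem norm_elasticMultiplierDeriv_le {R : ℝ} {z : W} (hz : ‖z‖ ≤ R) (v : W) :
    ‖elasticMultiplierDeriv r z v‖ ≤ (1 + 3 * R ^ 2 + r ^ 2) * ‖v‖ := by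
  have hv := norm_nonneg v
  have hz0 := norm_nonneg z
  have hzR : ‖z‖ ^ 2 ≤ R ^ 2 := by gcongr
  unfold elasticMultiplierDeriv
  split_ifs with h
  · nlinarith [sq_nonneg R, sq_nonneg r]
  · refine (norm_add_le _ _).trans ?_
    rw [norm_smul, norm_smul, Real.norm_eq_abs, Real.norm_eq_abs]
    have h1 : |2 * ⟪z, v⟫| * ‖z‖ ≤ 2 * R ^ 2 * ‖v‖ := by
      rw [abs_mul, abs_two]
      have := abs_real_inner_le_norm z v
      calc 2 * |⟪z, v⟫| * ‖z‖ ≤ 2 * (‖z‖ * ‖v‖) * ‖z‖ := by gcongr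
        _ = 2 * ‖z‖ ^ 2 * ‖v‖ := by ring
        _ ≤ _ := by gcongr
    have h2 : |‖z‖ ^ 2 - r ^ 2| ≤ R ^ 2 + r ^ 2 := by
      rw [abs_le]; constructor <;> nlinarith [sq_nonneg ‖z‖, sq_nonneg r]
    have h3 : |‖z‖ ^ 2 - r ^ 2| * ‖v‖ ≤ (R ^ 2 + r ^ 2) * ‖v‖ := by gcongr
    linarith

theorem norm_elasticMultiplier_le {R : ℝ} {z : W} (hz : ‖z‖ ≤ R) :
    ‖elasticMultiplier r z‖ ≤ (1 + R ^ 2 + r ^ 2) * R := by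
  have hz0 := norm_nonneg z
  have hzR : ‖z‖ ^ 2 ≤ R ^ 2 := by gcongr
  rw [elasticMultiplier, norm_smul]
  have : ‖(if r = 0 then 1 else ‖z‖ ^ 2 - r ^ 2 : ℝ)‖ ≤ 1 + R ^ 2 + r ^ 2 := by
    split_ifs
    · rw [norm_one]; linarith [sq_nonneg R, sq_nonneg r]
    · rw [Real.norm_eq_abs, abs_le]; constructor <;> nlinarith [sq_nonneg ‖z‖, sq_nonneg r]
  gcongr

theorem inner_elasticForce_elasticMultiplier (z : W) :
    ⟪elasticForce k r z, elasticMultiplier r z⟫ =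
      if r = 0 then k * ‖z‖ ^ 2 else k * ‖z‖ * (‖z‖ + r) * (‖z‖ - r) ^ 2 := by
  rw [elasticMultiplier, real_inner_smul_right, inner_elasticForce_self]
  split_ifs with h
  · rw [h]; ring
  · ring

theorem norm_elasticMultiplier_sq (z : W) :
    ‖elasticMultiplier r z‖ ^ 2 =
      if r = 0 then ‖z‖ ^ 2 else (‖z‖ * (‖z‖ + r)) ^ 2 * (‖z‖ - r) ^ 2 := by
  rw [elasticMultiplier, norm_smul, mul_pow, Real.norm_eq_abs, sq_abs]
  split_ifs with h
  · simp
  · ring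

/-- For `r > 0`, both sides contain `‖z‖ (‖z‖ + r) (‖z‖ - r)²`; the surplus factor `‖z‖ (‖z‖ + r)`
on the left is at most `R (R + r)`. -/
theorem exists_norm_elasticMultiplier_sq_le (hk : 0 < k) (hr : 0 ≤ r) {R : ℝ} (hR : 0 < R) :
    ∃ c > 0, ∀ z : W, ‖z‖ ≤ R →
      c * ‖elasticMultiplier r z‖ ^ 2 ≤ ⟪elasticForce k r z, elasticMultiplier r z⟫ := by
  by_cases h : r = 0
  · refine ⟨k, hk, fun z _ => ?_⟩
    simp [norm_elasticMultiplier_sq, inner_elasticForce_elasticMultiplier, h]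
  · refine ⟨k / (R * (R + r)), by positivity, fun z hz => ?_⟩
    rw [norm_elasticMultiplier_sq, inner_elasticForce_elasticMultiplier, if_neg h, if_neg h,
      div_mul_eq_mul_div, div_le_iff₀ (by positivity)]
    have hz0 := norm_nonneg z
    have h1 : ‖z‖ * (‖z‖ + r) ≤ R * (R + r) := by gcongr
    have h2 : 0 ≤ k * (‖z‖ * (‖z‖ + r)) * (‖z‖ - r) ^ 2 := by positivity
    nlinarith [mul_le_mul_of_nonneg_left h1 h2]

/-- The restriction to `‖z‖ ≥ r / 2` is essential: at the origin the multiplier vanishes while the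
energy is `½ k r²`. Hence exponential decay comes only after collapse has been excluded. -/
theorem exists_elasticEnergy_le (hk : 0 < k) (hr : 0 ≤ r) :
    ∃ c > 0, ∀ z : W, r / 2 ≤ ‖z‖ →
      c * elasticEnergy k r z ≤ ⟪elasticForce k r z, elasticMultiplier r z⟫ := by
  by_cases h : r = 0
  · refine ⟨2, two_pos, fun z _ => ?_⟩
    simp only [elasticEnergy, inner_elasticForce_elasticMultiplier, h, if_true]
    exact le_of_eq (by ring)
  · have hr' : 0 < r := lt_of_le_of_ne hr (Ne.symm h)
    refine ⟨r ^ 2, by positivity, fun z hz => ?_⟩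
    rw [inner_elasticForce_elasticMultiplier, if_neg h, elasticEnergy]
    have h1 : r ^ 2 / 2 ≤ ‖z‖ * (‖z‖ + r) := by nlinarith
    have h2 : 0 ≤ k * (‖z‖ - r) ^ 2 := by positivity
    nlinarith [mul_le_mul_of_nonneg_left h1 h2]

theorem exists_norm_elasticMultiplier_sq_le_energy (hk : 0 < k) (hr : 0 ≤ r) {R : ℝ}
    (hR : 0 < R) :
    ∃ c > 0, ∀ z : W, ‖z‖ ≤ R → c * ‖elasticMultiplier r z‖ ^ 2 ≤ elasticEnergy k r z := by
  by_cases h : r = 0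
  · refine ⟨1 / 2 * k, by positivity, fun z _ => ?_⟩
    simp [norm_elasticMultiplier_sq, elasticEnergy, h]
  · refine ⟨k / 2 / (R * (R + r)) ^ 2, by positivity, fun z hz => ?_⟩
    rw [norm_elasticMultiplier_sq, elasticEnergy, if_neg h,
      div_mul_eq_mul_div, div_le_iff₀ (by positivity)]
    have hz0 := norm_nonneg z
    have h1 : (‖z‖ * (‖z‖ + r)) ^ 2 ≤ (R * (R + r)) ^ 2 := by gcongr
    have h2 : 0 ≤ k / 2 * (‖z‖ - r) ^ 2 := by positivity
    nlinarith [mul_le_mul_of_nonneg_left h1 h2]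

end Spring

/-! ### Springs and dampers coupled by a positive definite matrix -/

section Flow

open scoped RealInnerProductSpace

variable {ι W : Type*} [Fintype ι] [DecidableEq ι] [NormedAddCommGroup W] [InnerProductSpace ℝ W]

omit [DecidableEq ι] in
-- Finiteness of `ι` makes the constants uniform; working near `0` from the right also covers an
-- empty index set.
theorem exists_pos_forall_of_forall_exists_pos {P : ι → ℝ → Prop}
    (hP : ∀ e c c', 0 < c' → c' ≤ c → P e c → P e c') (h : ∀ e, ∃ c > 0, P e c) :
    ∃ c > 0, ∀ e, P e c := by
  have hev : ∀ᶠ c in 𝓝[>] (0 : ℝ), ∀ e, P e c := by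
    rw [eventually_all]
    intro e
    obtain ⟨c, hc, hPc⟩ := h e
    filter_upwards [Ioc_mem_nhdsGT hc] with c' hc'
    exact hP e c c' hc'.1 hc'.2 hPc
  obtain ⟨c, h1, h2⟩ := (hev.and self_mem_nhdsWithin).exists
  exact ⟨c, h2, h1⟩

/-- The elongations `z` and the edge momenta `m` of springs (stiffness `k`, rest length `r`) and
dampers `D` coupled by a positive definite mobility matrix `a`. -/
structure IsSpringFlow (a : Matrix ι ι ℝ) (k r : ι → ℝ) (D : ι → W →L[ℝ] W)
    (z m : ℝ → ι → W) : Prop where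
  posDef : a.PosDef
  k_pos : ∀ e, 0 < k e
  r_nonneg : ∀ e, 0 ≤ r e
  damping : ∀ e, ∃ d > 0, ∀ v : W, d * ‖v‖ ^ 2 ≤ ⟪D e v, v⟫
  deriv_z : ∀ t > 0, ∀ e, HasDerivAt (fun s => z s e) (mixVec a (m t) e) t
  deriv_m : ∀ t > 0, ∀ e, HasDerivAt (fun s => m s e)
    (-(elasticForce (k e) (r e) (z t e) + D e (mixVec a (m t) e))) t
  smooth : ∀ t > 0, ∀ e, z t e ≠ 0 ∨ r e = 0

/-- The energy of the coupled springs, up to the kinetic energy of the barycentre. -/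
noncomputable def flowEnergy (a : Matrix ι ι ℝ) (k r : ι → ℝ) (z m : ι → W) : ℝ :=
  1 / 2 * ∑ e, ⟪m e, mixVec a m e⟫ + ∑ e, elasticEnergy (k e) (r e) (z e)

namespace IsSpringFlow

variable {a : Matrix ι ι ℝ} {k r : ι → ℝ} {D : ι → W →L[ℝ] W} {z m : ℝ → ι → W}

omit [DecidableEq ι] in
-- Symmetry of `a` makes the two halves of the kinetic term equal; the work of the springs then
-- cancels and only the damping remains.
theorem hasDerivAt_energy (h : IsSpringFlow a k r D z m) {t : ℝ} (ht : 0 < t) :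
    HasDerivAt (fun s => flowEnergy a k r (z s) (m s))
      (-∑ e, ⟪D e (mixVec a (m t) e), mixVec a (m t) e⟫) t := by
  have h1 : HasDerivAt (fun s => 1 / 2 * ∑ e, ⟪m s e, mixVec a (m s) e⟫) _ t :=
    (HasDerivAt.fun_sum fun e (_ : e ∈ Finset.univ) =>
      (h.deriv_m t ht e).inner ℝ (HasDerivAt.mixVec a (h.deriv_m t ht) e)).const_mul _
  have h2 : HasDerivAt (fun s => ∑ e, elasticEnergy (k e) (r e) (z s e)) _ t :=
    HasDerivAt.fun_sum fun e (_ : e ∈ Finset.univ) =>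
      (h.deriv_z t ht e).elasticEnergy (k := k e) (h.smooth t ht e)
  refine (h1.add h2).congr_deriv ?_
  have hsymm : aᵀ = a := by
    have := h.posDef.isHermitian
    rwa [Matrix.IsHermitian, Matrix.conjTranspose_eq_transpose_of_trivial] at this
  rw [Finset.sum_add_distrib, sum_inner_mixVec, hsymm, ← Finset.sum_neg_distrib,
    ← Finset.sum_add_distrib, Finset.mul_sum, ← Finset.sum_add_distrib]
  refine Finset.sum_congr rfl fun e _ => ?_
  simp only [inner_neg_right, inner_neg_left, inner_add_right, inner_add_left]
  rw [real_inner_comm (mixVec a (m t) e) (elasticForce _ _ _),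
    real_inner_comm (mixVec a (m t) e) (D e _)]
  ring

omit [DecidableEq ι] in
-- The base time is `1` because the two-sided derivatives of the flow are available only for `t >
-- 0`.
theorem energy_le (h : IsSpringFlow a k r D z m) {t : ℝ} (ht : 1 ≤ t) :
    flowEnergy a k r (z t) (m t) ≤ flowEnergy a k r (z 1) (m 1) := by
  refine antitoneOn_Ici_of_hasDerivAt_nonpos (T := 1) (u := fun s => flowEnergy a k r (z s) (m s))
    (fun s hs => h.hasDerivAt_energy (zero_lt_one.trans_le hs)) (fun s _ => ?_)
    (Set.mem_Ici.2 le_rfl) ht ht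
  rw [neg_nonpos]
  refine Finset.sum_nonneg fun e _ => ?_
  obtain ⟨d, hd, hD⟩ := h.damping e
  exact le_trans (by positivity) (hD _)

theorem exists_bound (h : IsSpringFlow a k r D z m) :
    ∃ R > 0, ∀ t ≥ 1, ∀ e, ‖z t e‖ ≤ R ∧ ‖m t e‖ ≤ R := by
  obtain ⟨l, hl, hcoer⟩ := h.posDef.exists_coercive (W := W)
  set E₀ := flowEnergy a k r (z 1) (m 1)
  have hkin : ∀ t, l * ∑ e, ‖m t e‖ ^ 2 ≤ ∑ e, ⟪m t e, mixVec a (m t) e⟫ := fun t => hcoer _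
  have hpot : ∀ t, 0 ≤ ∑ e, elasticEnergy (k e) (r e) (z t e) := fun t =>
    Finset.sum_nonneg fun e _ => elasticEnergy_nonneg (h.k_pos e) _
  have hkin0 : ∀ t, 0 ≤ l * ∑ e, ‖m t e‖ ^ 2 := fun t => by positivity
  have hE : ∀ t ≥ 1, 1 / 2 * ∑ e, ⟪m t e, mixVec a (m t) e⟫ +
      ∑ e, elasticEnergy (k e) (r e) (z t e) ≤ E₀ := fun t ht => h.energy_le ht
  have hE₀ : 0 ≤ E₀ := by
    have := hE 1 le_rfl
    have := hpot 1
    have := hkin 1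
    have := hkin0 1
    linarith
  have hz : ∀ t ≥ 1, ∀ e, ‖z t e‖ ≤ r e + 1 + 2 * E₀ / k e := by
    intro t ht e
    have h1 : elasticEnergy (k e) (r e) (z t e) ≤ E₀ := by
      have := Finset.single_le_sum (f := fun e => elasticEnergy (k e) (r e) (z t e))
        (fun e _ => elasticEnergy_nonneg (h.k_pos e) _) (Finset.mem_univ e)
      have := hE t ht
      have := hkin t
      have := hkin0 t
      linarith
    have h2 : (‖z t e‖ - r e) ^ 2 ≤ 2 * E₀ / k e := by
      rw [le_div_iff₀ (h.k_pos e)]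
      unfold elasticEnergy at h1
      linarith
    -- From `y² ≤ Y` follows `y ≤ 1 + Y`, which avoids square roots.
    nlinarith [sq_nonneg (‖z t e‖ - r e - 1)]
  have hm : ∀ t ≥ 1, ∀ e, ‖m t e‖ ≤ 1 + 2 * E₀ / l := by
    intro t ht e
    have h1 : ‖m t e‖ ^ 2 ≤ ∑ e, ‖m t e‖ ^ 2 :=
      Finset.single_le_sum (f := fun e => ‖m t e‖ ^ 2) (fun e _ => by positivity)
        (Finset.mem_univ e)
    have h2 : ‖m t e‖ ^ 2 ≤ 2 * E₀ / l := by
      rw [le_div_iff₀ hl]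
      have := hE t ht
      have := hkin t
      have := hpot t
      nlinarith
    nlinarith [sq_nonneg (‖m t e‖ - 1)]
  refine ⟨1 + 2 * E₀ / l + ∑ e, (r e + 1 + 2 * E₀ / k e), ?_, fun t ht e => ⟨?_, ?_⟩⟩
  · have : 0 ≤ ∑ e, (r e + 1 + 2 * E₀ / k e) := Finset.sum_nonneg fun e _ => by
      have := h.k_pos e; have := h.r_nonneg e; positivity
    positivity
  · refine (hz t ht e).trans ?_
    have := Finset.single_le_sum (f := fun e => r e + 1 + 2 * E₀ / k e) (fun e _ => by
      have := h.k_pos e; have := h.r_nonneg e; positivity) (Finset.mem_univ e)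
    have : 0 ≤ 2 * E₀ / l := by positivity
    linarith
  · refine (hm t ht e).trans ?_
    have : 0 ≤ ∑ e, (r e + 1 + 2 * E₀ / k e) := Finset.sum_nonneg fun e _ => by
      have := h.k_pos e; have := h.r_nonneg e; positivity
    linarith

omit [DecidableEq ι] in
theorem norm_damping_le (v : W) (e : ι) : ‖D e v‖ ≤ (∑ e, ‖D e‖) * ‖v‖ :=
  ((D e).le_opNorm v).trans (mul_le_mul_of_nonneg_right
    (Finset.single_le_sum (f := fun e => ‖D e‖) (fun _ _ => norm_nonneg _) (Finset.mem_univ e))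
    (norm_nonneg v))

/-- The energy with a cross term. -/
noncomputable def lyapunov (a : Matrix ι ι ℝ) (k r : ι → ℝ) (ε : ℝ) (z m : ι → W) : ℝ :=
  flowEnergy a k r z m + ε * ∑ e, ⟪m e, elasticMultiplier (r e) (z e)⟫

/-- The time derivative of `lyapunov`. -/
noncomputable def lyapunovDeriv (a : Matrix ι ι ℝ) (k r : ι → ℝ) (D : ι → W →L[ℝ] W) (ε : ℝ)
    (z m : ι → W) : ℝ :=
  -∑ e, ⟪D e (mixVec a m e), mixVec a m e⟫ +
    ε * ∑ e, (⟪m e, elasticMultiplierDeriv (r e) (z e) (mixVec a m e)⟫ +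
      ⟪-(elasticForce (k e) (r e) (z e) + D e (mixVec a m e)), elasticMultiplier (r e) (z e)⟫)

omit [DecidableEq ι] in
theorem hasDerivAt_lyapunov (h : IsSpringFlow a k r D z m) (ε : ℝ) {t : ℝ} (ht : 0 < t) :
    HasDerivAt (fun s => lyapunov a k r ε (z s) (m s)) (lyapunovDeriv a k r D ε (z t) (m t)) t :=
  (h.hasDerivAt_energy ht).add ((HasDerivAt.fun_sum fun e (_ : e ∈ Finset.univ) =>
    (h.deriv_m t ht e).inner ℝ (h.deriv_z t ht e).elasticMultiplier).const_mul ε)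

/-- The dissipation controlled by `lyapunov`. -/
noncomputable def dissipation (a : Matrix ι ι ℝ) (k r : ι → ℝ) (z m : ι → W) : ℝ :=
  ∑ e, (‖mixVec a m e‖ ^ 2 +
    ⟪elasticForce (k e) (r e) (z e), elasticMultiplier (r e) (z e)⟫)

/-- Coercivity gives `l² ∑ ‖m‖² ≤ l ∑ ⟪m, a m⟫`, and Young's inequality absorbs half of the left
side. -/
theorem exists_sum_norm_sq_le (ha : a.PosDef) :
    ∃ K > 0, ∀ m : ι → W, ∑ e, ‖m e‖ ^ 2 ≤ K * ∑ e, ‖mixVec a m e‖ ^ 2 := by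
  obtain ⟨l, hl, hcoer⟩ := ha.exists_coercive (W := W)
  refine ⟨(l ^ 2)⁻¹, by positivity, fun m => ?_⟩
  rw [← div_eq_inv_mul, le_div_iff₀ (by positivity)]
  have h1 : ∑ e, l * ⟪m e, mixVec a m e⟫ ≤
      ∑ e, (1 / 2 * (l ^ 2 * ‖m e‖ ^ 2) + 1 / 2 * ‖mixVec a m e‖ ^ 2) := by
    refine Finset.sum_le_sum fun e _ => ?_
    have := real_inner_le_norm (m e) (mixVec a m e)
    nlinarith [sq_nonneg (l * ‖m e‖ - ‖mixVec a m e‖)]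
  rw [← Finset.mul_sum, Finset.sum_add_distrib, ← Finset.mul_sum, ← Finset.mul_sum,
    ← Finset.mul_sum] at h1
  nlinarith [hcoer m]

theorem exists_lyapunov (h : IsSpringFlow a k r D z m) :
    ∃ ε > 0, ∃ c > 0, ∀ t ≥ 1,
      lyapunovDeriv a k r D ε (z t) (m t) ≤ -(c * dissipation a k r (z t) (m t)) ∧
      1 / 2 * flowEnergy a k r (z t) (m t) ≤ lyapunov a k r ε (z t) (m t) ∧
      lyapunov a k r ε (z t) (m t) ≤ 2 * flowEnergy a k r (z t) (m t) ∧
      ∀ e, c * ‖elasticMultiplier (r e) (z t e)‖ ^ 2 ≤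
        ⟪elasticForce (k e) (r e) (z t e), elasticMultiplier (r e) (z t e)⟫ := by
  obtain ⟨R, hR, hbd⟩ := h.exists_bound
  obtain ⟨l, hl, hcoer⟩ := h.posDef.exists_coercive (W := W)
  obtain ⟨K, hK, hmv⟩ := exists_sum_norm_sq_le (W := W) h.posDef
  obtain ⟨d, hd, hD⟩ := exists_pos_forall_of_forall_exists_pos
    (P := fun e d => ∀ v : W, d * ‖v‖ ^ 2 ≤ ⟪D e v, v⟫)
    (fun e c c' _ hcc hc v => le_trans (by gcongr) (hc v)) h.damping
  obtain ⟨κ, hκ, hψ⟩ := exists_pos_forall_of_forall_exists_pos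
    (P := fun e c => ∀ w : W, ‖w‖ ≤ R → c * ‖elasticMultiplier (r e) w‖ ^ 2 ≤
      ⟪elasticForce (k e) (r e) w, elasticMultiplier (r e) w⟫)
    (fun e c c' _ hcc hc v hv => le_trans (by gcongr) (hc v hv))
    fun e => exists_norm_elasticMultiplier_sq_le (h.k_pos e) (h.r_nonneg e) hR
  obtain ⟨η, hη, hψE⟩ := exists_pos_forall_of_forall_exists_pos
    (P := fun e c => ∀ w : W, ‖w‖ ≤ R → c * ‖elasticMultiplier (r e) w‖ ^ 2 ≤
      elasticEnergy (k e) (r e) w)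
    (fun e c c' _ hcc hc v hv => le_trans (by gcongr) (hc v hv))
    fun e => exists_norm_elasticMultiplier_sq_le_energy (h.k_pos e) (h.r_nonneg e) hR
  set CD := ∑ e, ‖D e‖ with hCD
  have hCD0 : 0 ≤ CD := Finset.sum_nonneg fun _ _ => norm_nonneg _
  obtain ⟨C, hC, hψ'⟩ : ∃ C > 0, ∀ e, ∀ w : W, ‖w‖ ≤ R → ∀ v,
      ‖elasticMultiplierDeriv (r e) w v‖ ≤ C * ‖v‖ := by
    refine ⟨1 + 3 * R ^ 2 + ∑ e, r e ^ 2, by positivity, fun e w hw v => ?_⟩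
    refine (norm_elasticMultiplierDeriv_le hw v).trans ?_
    have := Finset.single_le_sum (f := fun e => r e ^ 2) (fun e _ => sq_nonneg _)
      (Finset.mem_univ e)
    gcongr
  -- `M` is the price of the cross term in units of `∑ ‖v e‖²`: damping against `ψ`, and the
  -- derivative of `ψ` against `m`, with `∑ ‖m‖²` replaced by `K ∑ ‖v‖²`.
  set M := CD ^ 2 / (2 * κ) + C * (1 + K) with hM
  have hM0 : 0 < M := by positivity
  -- The first bound spends at most half of the damping on the cross term; the second keeps the
  -- cross term below half of the energy.
  obtain ⟨ε, hε, hε1, hε2⟩ : ∃ ε > 0, ε * M ≤ d / 2 ∧ ε * (2 / l + 1 / η) ≤ 1 / 2 := by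
    refine ⟨min (d / 2 / M) (1 / 2 / (2 / l + 1 / η)), by positivity, ?_, ?_⟩
    · rw [← le_div_iff₀ hM0]; exact min_le_left _ _
    · rw [← le_div_iff₀ (by positivity)]; exact min_le_right _ _
  refine ⟨ε, hε, min (min (d / 2) (ε / 2)) κ, by positivity, fun t ht => ?_⟩
  set v := mixVec a (m t) with hv
  set ψ := fun e => elasticMultiplier (r e) (z t e) with hψdef
  set f := fun e => elasticForce (k e) (r e) (z t e) with hf
  have hfψ : ∀ e, κ * ‖ψ e‖ ^ 2 ≤ ⟪f e, ψ e⟫ := fun e => hψ e _ (hbd t ht e).1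
  have hfψ0 : ∀ e, 0 ≤ ⟪f e, ψ e⟫ := fun e => le_trans (by positivity) (hfψ e)
  refine ⟨?_, ?_⟩
  · have hedge : ∀ e, ⟪m t e, elasticMultiplierDeriv (r e) (z t e) (v e)⟫ +
        ⟪-(f e + D e (v e)), ψ e⟫ ≤
        -(1 / 2 * ⟪f e, ψ e⟫) + (CD ^ 2 / (2 * κ) + C) * ‖v e‖ ^ 2 + C * ‖m t e‖ ^ 2 := by
      intro e
      have h1 : ⟪m t e, elasticMultiplierDeriv (r e) (z t e) (v e)⟫ ≤
          C * (‖m t e‖ ^ 2 + ‖v e‖ ^ 2) := by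
        refine (real_inner_le_norm _ _).trans ?_
        have h2 := hψ' e _ (hbd t ht e).1 (v e)
        calc ‖m t e‖ * ‖elasticMultiplierDeriv (r e) (z t e) (v e)‖
            ≤ ‖m t e‖ * (C * ‖v e‖) := by gcongr
          _ = C * (‖m t e‖ * ‖v e‖) := by ring
          _ ≤ _ := by
            gcongr
            nlinarith [sq_nonneg (‖m t e‖ - ‖v e‖), sq_nonneg ‖m t e‖, sq_nonneg ‖v e‖]
      -- Young's inequality, weighted so that the `ψ` term is absorbed by half of `⟪f, ψ⟫ ≥ κ ‖ψ‖²`.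
      have h3 : -⟪D e (v e), ψ e⟫ ≤ κ / 2 * ‖ψ e‖ ^ 2 + CD ^ 2 / (2 * κ) * ‖v e‖ ^ 2 := by
        have h4 : -⟪D e (v e), ψ e⟫ ≤ CD * ‖v e‖ * ‖ψ e‖ := by
          refine (neg_le_abs _).trans ((abs_real_inner_le_norm _ _).trans ?_)
          gcongr
          exact norm_damping_le _ _
        refine h4.trans ?_
        have h5 : κ / 2 * ‖ψ e‖ ^ 2 + CD ^ 2 / (2 * κ) * ‖v e‖ ^ 2 - CD * ‖v e‖ * ‖ψ e‖ =
            (κ * ‖ψ e‖ - CD * ‖v e‖) ^ 2 / (2 * κ) := by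
          field_simp; ring
        have : 0 ≤ (κ * ‖ψ e‖ - CD * ‖v e‖) ^ 2 / (2 * κ) := by positivity
        linarith
      rw [inner_neg_left, inner_add_left]
      have := hfψ e
      linarith
    have hsum := Finset.sum_le_sum fun e (_ : e ∈ Finset.univ) => hedge e
    have hDsum : d * ∑ e, ‖v e‖ ^ 2 ≤ ∑ e, ⟪D e (v e), v e⟫ := by
      rw [Finset.mul_sum]; exact Finset.sum_le_sum fun e _ => hD e _
    have hms := hmv (m t)
    simp only [Finset.sum_add_distrib, Finset.sum_neg_distrib, ← Finset.mul_sum] at hsum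
    have hdiss : dissipation a k r (z t) (m t) = ∑ e, ‖v e‖ ^ 2 + ∑ e, ⟪f e, ψ e⟫ :=
      Finset.sum_add_distrib
    rw [hdiss, lyapunovDeriv]
    simp only [Finset.sum_add_distrib]
    have hv0 : 0 ≤ ∑ e, ‖v e‖ ^ 2 := by positivity
    have hs0 : 0 ≤ ∑ e, ⟪f e, ψ e⟫ := Finset.sum_nonneg fun e _ => hfψ0 e
    have hc1 : min (min (d / 2) (ε / 2)) κ ≤ d / 2 := (min_le_left _ _).trans (min_le_left _ _)
    have hc2 : min (min (d / 2) (ε / 2)) κ ≤ ε / 2 := (min_le_left _ _).trans (min_le_right _ _)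
    generalize min (min (d / 2) (ε / 2)) κ = c at *
    have h6 := mul_le_mul_of_nonneg_left hsum hε.le
    have h7 : C * ∑ e, ‖m t e‖ ^ 2 ≤ C * (K * ∑ e, ‖v e‖ ^ 2) := by gcongr
    have h8 : ε * ((CD ^ 2 / (2 * κ) + C) * ∑ e, ‖v e‖ ^ 2 + C * ∑ e, ‖m t e‖ ^ 2) ≤
        d / 2 * ∑ e, ‖v e‖ ^ 2 := by
      calc _ ≤ ε * ((CD ^ 2 / (2 * κ) + C) * ∑ e, ‖v e‖ ^ 2 + C * (K * ∑ e, ‖v e‖ ^ 2)) := by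
            gcongr
        _ = ε * M * ∑ e, ‖v e‖ ^ 2 := by rw [hM]; ring
        _ ≤ _ := by gcongr
    have h9 : c * ∑ e, ‖v e‖ ^ 2 ≤ d / 2 * ∑ e, ‖v e‖ ^ 2 := by gcongr
    have h10 : c * ∑ e, ⟪f e, ψ e⟫ ≤ ε / 2 * ∑ e, ⟪f e, ψ e⟫ := by gcongr
    linarith
  · have hcross : |ε * ∑ e, ⟪m t e, ψ e⟫| ≤ 1 / 2 * flowEnergy a k r (z t) (m t) := by
      have h1 : |∑ e, ⟪m t e, ψ e⟫| ≤ ∑ e, ‖m t e‖ ^ 2 + ∑ e, ‖ψ e‖ ^ 2 := by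
        rw [← Finset.sum_add_distrib]
        refine (Finset.abs_sum_le_sum_abs _ _).trans (Finset.sum_le_sum fun e _ => ?_)
        refine (abs_real_inner_le_norm _ _).trans ?_
        nlinarith [sq_nonneg (‖m t e‖ - ‖ψ e‖), sq_nonneg ‖m t e‖, sq_nonneg ‖ψ e‖]
      have h2 : ∑ e, ‖m t e‖ ^ 2 ≤ 1 / l * ∑ e, ⟪m t e, v e⟫ := by
        rw [one_div, ← div_eq_inv_mul, le_div_iff₀ hl, mul_comm]
        exact hcoer (m t)
      have h3 : ∑ e, ‖ψ e‖ ^ 2 ≤ 1 / η * ∑ e, elasticEnergy (k e) (r e) (z t e) := by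
        rw [one_div, ← div_eq_inv_mul, le_div_iff₀ hη, mul_comm, Finset.mul_sum]
        exact Finset.sum_le_sum fun e _ => hψE e _ (hbd t ht e).1
      have hp0 : 0 ≤ ∑ e, elasticEnergy (k e) (r e) (z t e) :=
        Finset.sum_nonneg fun e _ => elasticEnergy_nonneg (h.k_pos e) _
      have hk0 : 0 ≤ ∑ e, ⟪m t e, v e⟫ := le_trans (by positivity) (hcoer (m t))
      rw [abs_mul, abs_of_pos hε, flowEnergy]
      have h4 : |∑ e, ⟪m t e, ψ e⟫| ≤ (2 / l + 1 / η) *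
          (1 / 2 * ∑ e, ⟪m t e, v e⟫ + ∑ e, elasticEnergy (k e) (r e) (z t e)) := by
        have h5 : 0 ≤ 1 / η * (1 / 2 * ∑ e, ⟪m t e, v e⟫) := by positivity
        have h6 : 0 ≤ 2 / l * ∑ e, elasticEnergy (k e) (r e) (z t e) := by positivity
        calc _ ≤ _ := h1
          _ ≤ _ := add_le_add h2 h3
          _ ≤ _ := by
            rw [add_mul, mul_add, mul_add]
            have : 2 / l * (1 / 2 * ∑ e, ⟪m t e, v e⟫) = 1 / l * ∑ e, ⟪m t e, v e⟫ := by ring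
            linarith
      calc _ ≤ ε * ((2 / l + 1 / η) *
          (1 / 2 * ∑ e, ⟪m t e, v e⟫ + ∑ e, elasticEnergy (k e) (r e) (z t e))) := by gcongr
        _ = ε * (2 / l + 1 / η) *
          (1 / 2 * ∑ e, ⟪m t e, v e⟫ + ∑ e, elasticEnergy (k e) (r e) (z t e)) := by ring
        _ ≤ _ := by gcongr
    have hE0 : 0 ≤ flowEnergy a k r (z t) (m t) := by
      have := (abs_nonneg _).trans hcross
      linarith
    rw [abs_le] at hcross
    refine ⟨?_, ?_, fun e => le_trans ?_ (hfψ e)⟩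
    · rw [lyapunov]; linarith [hcross.1]
    · rw [lyapunov]; linarith [hcross.2]
    · gcongr; exact min_le_right _ _

end IsSpringFlow

end Flow

/-! ### Asymptotics of the spring flow: rest lengths and exponential decay -/

namespace IsSpringFlow

open scoped RealInnerProductSpace

variable {ι W : Type*} [Fintype ι] [DecidableEq ι] [NormedAddCommGroup W] [InnerProductSpace ℝ W]
  {a : Matrix ι ι ℝ} {k r : ι → ℝ} {D : ι → W →L[ℝ] W} {z m : ℝ → ι → W}

theorem exists_bound_mixVec (h : IsSpringFlow a k r D z m) :
    ∃ V > 0, ∀ t ≥ 1, ∀ e, ‖mixVec a (m t) e‖ ≤ V := by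
  obtain ⟨R, hR, hbd⟩ := h.exists_bound
  obtain ⟨C, hC, hmix⟩ := exists_norm_mixVec_le (W := W) a
  refine ⟨1 + C * (Fintype.card ι * R ^ 2), by positivity, fun t ht e => ?_⟩
  have h1 : ∑ e, ‖m t e‖ ^ 2 ≤ Fintype.card ι * R ^ 2 := by
    calc ∑ e, ‖m t e‖ ^ 2 ≤ ∑ _e : ι, R ^ 2 := Finset.sum_le_sum fun e _ => by
          gcongr; exact (hbd t ht e).2
      _ = _ := by simp
  have h2 := hmix (m t) e
  have h3 : C * ∑ e, ‖m t e‖ ^ 2 ≤ C * (Fintype.card ι * R ^ 2) := by gcongr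
  nlinarith [sq_nonneg (‖mixVec a (m t) e‖ - 1)]

/-- Barbalat's lemma for the Lyapunov function, on the bounded region that contains the flow. -/
theorem tendsto_zero (h : IsSpringFlow a k r D z m) :
    (∀ e, Tendsto (fun t => m t e) atTop (𝓝 0)) ∧
      ∀ e, Tendsto (fun t => elasticMultiplier (r e) (z t e)) atTop (𝓝 0) := by
  obtain ⟨ε, hε, c, hc, hlyap⟩ := h.exists_lyapunov
  obtain ⟨R, hR, hbd⟩ := h.exists_bound
  obtain ⟨V, hV, hv⟩ := h.exists_bound_mixVec
  obtain ⟨K, hK, hmv⟩ := exists_sum_norm_sq_le (W := W) h.posDef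
  -- A lower bound for `c * dissipation` that is polynomial in `m` and `z`, hence differentiable
  -- along the flow with bounded derivative.
  set F : ℝ → ℝ := fun t => ∑ e, (c * K⁻¹ * ‖m t e‖ ^ 2 +
    c * c * ‖elasticMultiplier (r e) (z t e)‖ ^ 2) with hF
  have hF0 : ∀ t, 0 ≤ F t := fun t => Finset.sum_nonneg fun e _ => by positivity
  have hlim : Tendsto F atTop (𝓝 0) := by
    refine tendsto_zero_of_dissipation (T := 1) (B := 0)
      (U := fun t => lyapunov a k r ε (z t) (m t))
      (F' := fun t => ∑ e, (c * K⁻¹ * (2 * ⟪m t e,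
        -(elasticForce (k e) (r e) (z t e) + D e (mixVec a (m t) e))⟫) +
        c * c * (2 * ⟪elasticMultiplier (r e) (z t e),
          elasticMultiplierDeriv (r e) (z t e) (mixVec a (m t) e)⟫)))
      (L := ∑ e, (c * K⁻¹ * (2 * (R * (k e * (R + r e) + (∑ e, ‖D e‖) * V))) +
        c * c * (2 * ((1 + R ^ 2 + r e ^ 2) * R * ((1 + 3 * R ^ 2 + r e ^ 2) * V)))))
      (fun t ht => h.hasDerivAt_lyapunov ε (zero_lt_one.trans_le ht)) (fun t ht => ?_)
      (fun t ht => ?_) (fun t _ => hF0 t) (fun t ht => ?_) fun t ht => ?_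
    · refine (hlyap t ht).1.trans ?_
      rw [neg_le_neg_iff, hF, dissipation]
      simp only [Finset.sum_add_distrib, ← Finset.mul_sum]
      rw [mul_add]
      refine add_le_add ?_ ?_
      · rw [mul_assoc]
        gcongr
        rw [inv_mul_le_iff₀ hK]
        exact hmv _
      · rw [mul_assoc]
        gcongr
        rw [Finset.mul_sum]
        exact Finset.sum_le_sum fun e _ => (hlyap t ht).2.2.2 e
    · refine le_trans ?_ (hlyap t ht).2.1
      obtain ⟨l, hl, hcoer⟩ := h.posDef.exists_coercive (W := W)
      have h1 : 0 ≤ ∑ e, ⟪m t e, mixVec a (m t) e⟫ := le_trans (by positivity) (hcoer (m t))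
      have h2 : 0 ≤ ∑ e, elasticEnergy (k e) (r e) (z t e) :=
        Finset.sum_nonneg fun e _ => elasticEnergy_nonneg (h.k_pos e) _
      rw [flowEnergy]
      positivity
    · have ht' := zero_lt_one.trans_le ht
      exact HasDerivAt.fun_sum fun e _ => ((h.deriv_m t ht' e).norm_sq.const_mul _).add
        ((h.deriv_z t ht' e).elasticMultiplier.norm_sq.const_mul _)
    · rw [← Finset.sum_neg_distrib]
      refine Finset.sum_le_sum fun e _ => ?_
      obtain ⟨hzR, hmR⟩ := hbd t ht e
      have hk := h.k_pos e
      have hr := h.r_nonneg e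
      have hCD : 0 ≤ ∑ e, ‖D e‖ := Finset.sum_nonneg fun _ _ => norm_nonneg _
      have h1 : -(R * (k e * (R + r e) + (∑ e, ‖D e‖) * V)) ≤ ⟪m t e,
          -(elasticForce (k e) (r e) (z t e) + D e (mixVec a (m t) e))⟫ := by
        refine neg_le_of_abs_le ((abs_real_inner_le_norm _ _).trans ?_)
        rw [norm_neg]
        have h2 : ‖elasticForce (k e) (r e) (z t e)‖ ≤ k e * (R + r e) := by
          refine (norm_elasticForce_le hk _).trans ?_
          gcongr
          rw [abs_le]; constructor <;> linarith [norm_nonneg (z t e)]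
        have h3 : ‖D e (mixVec a (m t) e)‖ ≤ (∑ e, ‖D e‖) * V :=
          (norm_damping_le _ e).trans (by gcongr; exact hv t ht e)
        gcongr
        exact (norm_add_le _ _).trans (add_le_add h2 h3)
      have h2 : -((1 + R ^ 2 + r e ^ 2) * R * ((1 + 3 * R ^ 2 + r e ^ 2) * V)) ≤
          ⟪elasticMultiplier (r e) (z t e),
            elasticMultiplierDeriv (r e) (z t e) (mixVec a (m t) e)⟫ := by
        refine neg_le_of_abs_le ((abs_real_inner_le_norm _ _).trans ?_)
        have h3 := norm_elasticMultiplier_le (r := r e) hzR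
        have h4 : ‖elasticMultiplierDeriv (r e) (z t e) (mixVec a (m t) e)‖ ≤
            (1 + 3 * R ^ 2 + r e ^ 2) * V :=
          (norm_elasticMultiplierDeriv_le hzR _).trans (by gcongr; exact hv t ht e)
        gcongr
      rw [neg_add, ← mul_neg, ← mul_neg, ← mul_neg, ← mul_neg]
      refine add_le_add ?_ ?_ <;> refine mul_le_mul_of_nonneg_left ?_ (by positivity)
      · linarith
      · linarith
  have key : ∀ {g : ℝ → W} {b : ℝ}, 0 < b → (∀ t, b * ‖g t‖ ^ 2 ≤ F t) →
      Tendsto g atTop (𝓝 0) := by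
    intro g b hb hg
    rw [tendsto_zero_iff_norm_tendsto_zero]
    have h1 : Tendsto (fun t => √(b⁻¹ * F t)) atTop (𝓝 0) := by
      simpa using (hlim.const_mul b⁻¹).sqrt
    refine squeeze_zero (fun _ => norm_nonneg _) (fun t => Real.le_sqrt_of_sq_le ?_) h1
    rw [← div_eq_inv_mul, le_div_iff₀ hb, mul_comm]
    exact hg t
  have hle : ∀ t e, c * K⁻¹ * ‖m t e‖ ^ 2 + c * c * ‖elasticMultiplier (r e) (z t e)‖ ^ 2 ≤ F t :=
    fun t e => Finset.single_le_sum (f := fun e => c * K⁻¹ * ‖m t e‖ ^ 2 +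
      c * c * ‖elasticMultiplier (r e) (z t e)‖ ^ 2) (fun e _ => by positivity) (Finset.mem_univ e)
  refine ⟨fun e => key (b := c * K⁻¹) (by positivity) fun t => le_trans ?_ (hle t e),
    fun e => key (b := c * c) (by positivity) fun t => le_trans ?_ (hle t e)⟩
  · exact le_add_of_nonneg_right (by positivity)
  · exact le_add_of_nonneg_left (by positivity)

theorem tendsto_norm_or (h : IsSpringFlow a k r D z m) (e : ι) :
    (0 < r e ∧ Tendsto (fun t => ‖z t e‖) atTop (𝓝 0)) ∨
      Tendsto (fun t => ‖z t e‖) atTop (𝓝 (r e)) := by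
  have h1 := (h.tendsto_zero.2 e).norm
  rw [norm_zero] at h1
  by_cases hr : r e = 0
  · right
    simpa [elasticMultiplier, hr] using h1
  · have hr' : 0 < r e := lt_of_le_of_ne (h.r_nonneg e) (Ne.symm hr)
    have h2 : Tendsto (fun t => ‖z t e‖ * (‖z t e‖ ^ 2 - r e ^ 2)) atTop (𝓝 0) := by
      rw [tendsto_zero_iff_norm_tendsto_zero]
      refine h1.congr fun t => ?_
      rw [elasticMultiplier, if_neg hr, norm_smul, norm_mul, norm_norm, mul_comm]
    refine (tendsto_zero_or_of_tendsto_mul (T := 1) hr' (fun _ _ => norm_nonneg _)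
      (fun t ht => ?_) h2).imp_left fun h3 => ⟨hr', h3⟩
    exact (h.deriv_z t (zero_lt_one.trans_le ht) e).continuousAt.norm.continuousWithinAt

omit [DecidableEq ι] in
theorem tendsto_elasticForce (h : IsSpringFlow a k r D z m) {e : ι}
    (he : Tendsto (fun t => ‖z t e‖) atTop (𝓝 (r e))) :
    Tendsto (fun t => elasticForce (k e) (r e) (z t e)) atTop (𝓝 0) := by
  refine squeeze_zero_norm (fun t => norm_elasticForce_le (h.k_pos e) _) ?_
  simpa using ((he.sub_const (r e)).abs).const_mul (k e)

/-- No set of springs collapses: the forces of the springs that are nearly contracted to a point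
push the kinetic energy of their elongations up. -/
theorem not_tendsto_norm_zero (h : IsSpringFlow a k r D z m) (e₀ : ι) (hr₀ : 0 < r e₀)
    (he₀ : Tendsto (fun t => ‖z t e₀‖) atTop (𝓝 0)) : False := by
  classical
  set P : ι → Prop := fun e => 0 < r e ∧ Tendsto (fun t => ‖z t e‖) atTop (𝓝 0) with hP
  -- All the collapsing springs are treated together: the forces of the others tend to zero, so
  -- nothing outside `S` competes with the repulsion inside.
  set S := {e // P e}
  set aS : Matrix S S ℝ := a.submatrix Subtype.val Subtype.val with haS
  have hposS : aS.PosDef := h.posDef.submatrix Subtype.val_injective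
  set Q := aS⁻¹ with hQ
  have hQpos : Q.PosDef := hposS.inv
  have hQa : Q * aS = 1 :=
    Matrix.nonsing_inv_mul _ ((Matrix.isUnit_iff_isUnit_det _).mp hposS.isUnit)
  have hQsymm : Qᵀ = Q := by
    have := hQpos.isHermitian
    rwa [Matrix.IsHermitian, Matrix.conjTranspose_eq_transpose_of_trivial] at this
  obtain ⟨l, hl, hcoer⟩ := hQpos.exists_coercive (W := W)
  obtain ⟨C, hC, hmix⟩ := exists_norm_mixVec_le (W := W) Q
  -- `A` is chosen so that its columns in `S` form the identity. Then `w = A m = Q v_S`, and each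
  -- component of `w'` contains the force of its own spring, without mixing the collapsing springs.
  set A : Matrix S ι ℝ := Q * (a.submatrix Subtype.val id : Matrix S ι ℝ) with hA
  set zS : ℝ → S → W := fun t e => z t e with hzS
  set vS : ℝ → S → W := fun t e => mixVec a (m t) e with hvS
  set w : ℝ → S → W := fun t => mixVec A (m t) with hw
  set F : ℝ → ι → W := fun t e => elasticForce (k e) (r e) (z t e) + D e (mixVec a (m t) e) with hF
  have hwQ : ∀ t, w t = mixVec Q (vS t) := fun t => by
    ext e
    rw [hw, hA]
    exact mixVec_mul _ _ _ _
  have hzS' : ∀ t > 0, ∀ e, HasDerivAt (fun s => zS s e) (vS t e) t := fun t ht e =>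
    h.deriv_z t ht e
  have hy' : ∀ t > 0, ∀ e, HasDerivAt (fun s => mixVec Q (zS s) e) (w t e) t := fun t ht e => by
    rw [hwQ]
    exact HasDerivAt.mixVec Q (hzS' t ht) e
  have hw' : ∀ t > 0, ∀ e, HasDerivAt (fun s => w s e) (mixVec A (fun e => - F t e) e) t :=
    fun t ht e => HasDerivAt.mixVec A (h.deriv_m t ht) e
  have hm0 := h.tendsto_zero.1
  have hv0 : ∀ e, Tendsto (fun t => mixVec a (m t) e) atTop (𝓝 0) := fun e => by
    simpa [mixVec_zero] using Filter.Tendsto.mixVec a hm0 e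
  have hz0 : ∀ e, Tendsto (fun t => zS t e) atTop (𝓝 0) := fun e =>
    tendsto_zero_iff_norm_tendsto_zero.2 e.2.2
  have hy0 : ∀ e, Tendsto (fun t => mixVec Q (zS t) e) atTop (𝓝 0) := fun e => by
    simpa [mixVec_zero] using Filter.Tendsto.mixVec Q hz0 e
  have hw0 : ∀ e, Tendsto (fun t => w t e) atTop (𝓝 0) := fun e => by
    simpa [mixVec_zero] using Filter.Tendsto.mixVec A hm0 e
  -- up to a vanishing term, `w` is driven by the forces of the contracted springs only
  have hrem : ∀ e : S, Tendsto (fun t => elasticForce (k e) (r e) (z t e) +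
      mixVec A (fun e => - F t e) e) atTop (𝓝 0) := by
    intro e
    have hsum : ∀ t, elasticForce (k e) (r e) (z t e) + mixVec A (fun e => - F t e) e =
        ∑ j : ι, (((if j = (e : ι) then 1 else 0) - A e j) • elasticForce (k j) (r j) (z t j) -
          A e j • D j (mixVec a (m t) j)) := by
      intro t
      simp only [hF, mixVec, sub_smul, Finset.sum_sub_distrib, ite_smul, one_smul, zero_smul,
        Finset.sum_ite_eq', Finset.mem_univ, if_true, smul_neg, smul_add, Finset.sum_neg_distrib,
        Finset.sum_add_distrib]
      abel
    simp only [hsum]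
    rw [← Finset.sum_const_zero (M := W) (s := (Finset.univ : Finset ι))]
    refine tendsto_finsetSum _ fun j _ => ?_
    have hD : Tendsto (fun t => A e j • D j (mixVec a (m t) j)) atTop (𝓝 0) := by
      simpa using (((D j).continuous.tendsto 0).comp (hv0 j)).const_smul (A e j)
    rw [← sub_zero (0 : W)]
    refine Tendsto.sub ?_ hD
    by_cases hj : P j
    · have hAj : A e j = (1 : Matrix S S ℝ) e ⟨j, hj⟩ := by
        rw [← hQa, hA, Matrix.mul_apply, Matrix.mul_apply]
        rfl
      have : (if j = e then (1 : ℝ) else 0) - A e j = 0 := by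
        rw [hAj, Matrix.one_apply, sub_eq_zero]
        congr 1
        exact propext ⟨fun hje => Subtype.ext hje.symm, fun hje => (congrArg Subtype.val hje).symm⟩
      simp only [this, zero_smul]
      exact tendsto_const_nhds
    · have hf := h.tendsto_elasticForce ((h.tendsto_norm_or j).resolve_left hj)
      simpa using hf.const_smul ((if j = e then (1 : ℝ) else 0) - A e j)
  -- The coefficient `k (r - ‖z‖)`, diminished by the remainder, tends to `k r`, so it eventually
  -- exceeds half of that.
  obtain ⟨c, hc, hcS⟩ := exists_pos_forall_of_forall_exists_pos
    (P := fun (e : S) c => c ≤ k e * r e / 2) (fun e c c' _ hcc hc => hcc.trans hc)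
    fun e => ⟨k e * r e / 2, by have := h.k_pos e; have := e.2.1; positivity, le_rfl⟩
  have hev : ∀ᶠ t in atTop, ∀ e : S, c ≤ k e * (r e - ‖z t e‖) -
      ‖elasticForce (k e) (r e) (z t e) + mixVec A (fun e => - F t e) e‖ := by
    rw [eventually_all]
    intro e
    have h1 : Tendsto (fun t => k e * (r e - ‖z t e‖) -
        ‖elasticForce (k e) (r e) (z t e) + mixVec A (fun e => - F t e) e‖) atTop
        (𝓝 (k e * r e)) := by
      simpa using ((e.2.2.const_sub (r e)).const_mul (k e)).sub (hrem e).norm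
    have h2 : c < k e * r e := (hcS e).trans_lt (half_lt_self (mul_pos (h.k_pos e) e.2.1))
    filter_upwards [h1.eventually (lt_mem_nhds h2)] with t ht using ht.le
  obtain ⟨T, hT⟩ := eventually_atTop.1 (hev.and (eventually_gt_atTop 0))
  set B := √C / 2 with hB
  have hBpos : 0 < B := by positivity
  -- Weighting by `Q` gives `u' = ∑ ⟪z, w⟫` and `u'' = ∑ ⟪z, w'⟫ + ∑ ⟪v, Q v⟫`, whose last sum is
  -- nonnegative.
  set u : ℝ → ℝ := fun t => 1 / 2 * ∑ e, ⟪zS t e, mixVec Q (zS t) e⟫ with hu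
  refine not_tendsto_zero_of_sqrt_le_deriv_deriv (T := T) (c := c / √B) (by positivity) (u := u)
    (u₁ := fun t => ∑ e, ⟪zS t e, w t e⟫)
    (u₂ := fun t => ∑ e, (⟪zS t e, mixVec A (fun e => - F t e) e⟫ + ⟪vS t e, w t e⟫))
    (fun t ht => ?_) (fun t ht => ?_) (fun t ht => ?_) (fun t ht => ?_) ?_ ?_
  · have ht0 := (hT t ht).2
    refine ((HasDerivAt.fun_sum fun e (_ : e ∈ Finset.univ) =>
      (hzS' t ht0 e).inner ℝ (hy' t ht0 e)).const_mul (1 / 2)).congr_deriv ?_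
    rw [Finset.sum_add_distrib, sum_inner_mixVec Q (vS t), hQsymm, ← hwQ]
    simp only [real_inner_comm (w t _) (zS t _)]
    ring
  · have ht0 := (hT t ht).2
    exact HasDerivAt.fun_sum fun e _ => (hzS' t ht0 e).inner ℝ (hw' t ht0 e)
  · have hne : z t e₀ ≠ 0 := (h.smooth t (hT t ht).2 e₀).resolve_right hr₀.ne'
    have h1 : 0 < ∑ e, ‖zS t e‖ ^ 2 := by
      refine Finset.sum_pos' (fun e _ => by positivity)
        ⟨⟨e₀, hr₀, he₀⟩, Finset.mem_univ _, ?_⟩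
      have : 0 < ‖z t e₀‖ := norm_pos_iff.2 hne
      exact pow_pos this 2
    have h2 := hcoer (zS t)
    have h3 : 0 < l * ∑ e, ‖zS t e‖ ^ 2 := by positivity
    rw [hu]
    simp only
    linarith
  · have hs0 : 0 ≤ ∑ e, ‖zS t e‖ := Finset.sum_nonneg fun e _ => norm_nonneg _
    have h1 : c * ∑ e, ‖zS t e‖ ≤
        ∑ e, (⟪zS t e, mixVec A (fun e => - F t e) e⟫ + ⟪vS t e, w t e⟫) := by
      rw [Finset.sum_add_distrib]
      have h2 : 0 ≤ ∑ e, ⟪vS t e, w t e⟫ := by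
        rw [hwQ]
        exact le_trans (by positivity) (hcoer (vS t))
      refine le_trans ?_ (le_add_of_nonneg_right h2)
      rw [Finset.mul_sum]
      refine Finset.sum_le_sum fun e _ => ?_
      set o := elasticForce (k e) (r e) (z t e) + mixVec A (fun e => - F t e) e with ho
      have h3 : mixVec A (fun e => - F t e) e = o - elasticForce (k e) (r e) (z t e) := by
        rw [ho]; abel
      have h4 : ⟪z t e, elasticForce (k e) (r e) (z t e)⟫ = k e * ‖z t e‖ * (‖z t e‖ - r e) := by
        rw [real_inner_comm, inner_elasticForce_self]
      have h5 : -(‖z t e‖ * ‖o‖) ≤ ⟪z t e, o⟫ :=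
        neg_le_of_abs_le (abs_real_inner_le_norm _ _)
      have h6 := mul_le_mul_of_nonneg_right ((hT t ht).1 e) (norm_nonneg (z t e))
      rw [h3, inner_sub_right, hzS]
      simp only
      rw [h4]
      linarith
    -- The lower bound on `u''` is linear in the elongations while `u` is quadratic; this is where
    -- `√u` comes from.
    have h2 : u t ≤ B * (∑ e, ‖zS t e‖) ^ 2 := by
      have h3 : ∀ e, ‖mixVec Q (zS t) e‖ ≤ √C * ∑ e, ‖zS t e‖ := by
        intro e
        refine abs_le_of_sq_le_sq' ?_ (by positivity) |>.2
        rw [mul_pow, Real.sq_sqrt hC.le]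
        refine (hmix (zS t) e).trans ?_
        gcongr
        exact Finset.sum_sq_le_sq_sum_of_nonneg fun _ _ => norm_nonneg _
      have h4 : ∑ e, ⟪zS t e, mixVec Q (zS t) e⟫ ≤ ∑ e, ‖zS t e‖ * (√C * ∑ e, ‖zS t e‖) :=
        Finset.sum_le_sum fun e _ => (real_inner_le_norm _ _).trans (by gcongr; exact h3 e)
      rw [← Finset.sum_mul] at h4
      rw [hu, hB]
      simp only
      nlinarith
    have h3 : √(u t) ≤ √B * ∑ e, ‖zS t e‖ := by
      rw [Real.sqrt_le_left (by positivity), mul_pow, Real.sq_sqrt hBpos.le]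
      exact h2
    refine le_trans ?_ h1
    rw [div_mul_eq_mul_div, div_le_iff₀ (by positivity)]
    calc c * √(u t) ≤ c * (√B * ∑ e, ‖zS t e‖) := by gcongr
      _ = _ := by ring
  · have := (tendsto_finsetSum Finset.univ fun e (_ : e ∈ Finset.univ) =>
      (hz0 e).inner (𝕜 := ℝ) (hy0 e)).const_mul (1 / 2)
    simpa [hu] using this
  · have := tendsto_finsetSum Finset.univ fun e (_ : e ∈ Finset.univ) =>
      (hz0 e).inner (𝕜 := ℝ) (hw0 e)
    simpa using this

theorem tendsto_norm (h : IsSpringFlow a k r D z m) (e : ι) :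
    Tendsto (fun t => ‖z t e‖) atTop (𝓝 (r e)) :=
  (h.tendsto_norm_or e).resolve_left fun he => h.not_tendsto_norm_zero e he.1 he.2

/-- The momenta decay exponentially. -/
theorem exists_norm_le_exp (h : IsSpringFlow a k r D z m) :
    ∃ C μ T, 0 < μ ∧ ∀ t ≥ T, ∀ e, ‖m t e‖ ≤ C * Real.exp (-(μ * t)) := by
  obtain ⟨ε, hε, c, hc, hlyap⟩ := h.exists_lyapunov
  obtain ⟨l, hl, hcoer⟩ := h.posDef.exists_coercive (W := W)
  obtain ⟨K, hK, hmv⟩ := exists_sum_norm_sq_le (W := W) h.posDef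
  obtain ⟨κ, hκ, hen⟩ := exists_pos_forall_of_forall_exists_pos
    (P := fun e c => ∀ w : W, r e / 2 ≤ ‖w‖ → c * elasticEnergy (k e) (r e) w ≤
      ⟪elasticForce (k e) (r e) w, elasticMultiplier (r e) w⟫)
    (fun e c c' _ hcc hc w hw => le_trans
      (mul_le_mul_of_nonneg_right hcc (elasticEnergy_nonneg (h.k_pos e) w)) (hc w hw))
    fun e => exists_elasticEnergy_le (h.k_pos e) (h.r_nonneg e)
  have hev : ∀ᶠ t in atTop, ∀ e, r e / 2 ≤ ‖z t e‖ := by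
    rw [eventually_all]
    intro e
    by_cases hr : r e = 0
    · exact Eventually.of_forall fun t => by rw [hr]; simp
    · have hr' : 0 < r e := lt_of_le_of_ne (h.r_nonneg e) (Ne.symm hr)
      filter_upwards [(h.tendsto_norm e).eventually (lt_mem_nhds (half_lt_self hr'))] with t ht
        using ht.le
  obtain ⟨T, hT⟩ := eventually_atTop.1 (hev.and (eventually_ge_atTop 1))
  -- Twice the energy is at most `N` times the dissipation: `1 + K` comes from the kinetic part, `2
  -- / κ` from the elastic part.
  set N := 1 + K + 2 / κ with hN
  have hN0 : 0 < N := by positivity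
  have hpot : ∀ t, 0 ≤ ∑ e, elasticEnergy (k e) (r e) (z t e) := fun t =>
    Finset.sum_nonneg fun e _ => elasticEnergy_nonneg (h.k_pos e) _
  have hdecay := exp_decay_of_deriv_le (T := T) (c := c / N)
    (U := fun t => lyapunov a k r ε (z t) (m t))
    (fun t ht => h.hasDerivAt_lyapunov ε (zero_lt_one.trans_le (hT t ht).2)) fun t ht => by
      obtain ⟨h1, h2, h3, h4⟩ := hlyap t (hT t ht).2
      refine h1.trans (neg_le_neg ?_)
      rw [div_mul_eq_mul_div, mul_div_assoc]
      refine mul_le_mul_of_nonneg_left ?_ hc.le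
      rw [div_le_iff₀ hN0]
      refine h3.trans ?_
      rw [flowEnergy, dissipation, Finset.sum_add_distrib]
      have h5 : ∑ e, ⟪m t e, mixVec a (m t) e⟫ ≤
          ∑ e, (‖m t e‖ ^ 2 + ‖mixVec a (m t) e‖ ^ 2) := by
        refine Finset.sum_le_sum fun e _ => (real_inner_le_norm _ _).trans ?_
        nlinarith [sq_nonneg (‖m t e‖ - ‖mixVec a (m t) e‖), sq_nonneg ‖m t e‖,
          sq_nonneg ‖mixVec a (m t) e‖]
      rw [Finset.sum_add_distrib] at h5
      have h6 := hmv (m t)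
      have h7 : κ * ∑ e, elasticEnergy (k e) (r e) (z t e) ≤
          ∑ e, ⟪elasticForce (k e) (r e) (z t e), elasticMultiplier (r e) (z t e)⟫ := by
        rw [Finset.mul_sum]
        exact Finset.sum_le_sum fun e _ => hen e _ ((hT t ht).1 e)
      set X := ∑ e, ‖mixVec a (m t) e‖ ^ 2
      set Y := ∑ e, ⟪elasticForce (k e) (r e) (z t e), elasticMultiplier (r e) (z t e)⟫
      have hX : 0 ≤ X := Finset.sum_nonneg fun e _ => by positivity
      have hY : 0 ≤ Y := le_trans (mul_nonneg hκ.le (hpot t)) h7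
      have h8 : ∑ e, elasticEnergy (k e) (r e) (z t e) ≤ Y / κ := by
        rw [le_div_iff₀ hκ]; linarith
      have h9 : (X + Y) * N = X + K * X + 2 / κ * X + Y + K * Y + 2 * (Y / κ) := by
        rw [hN]; ring
      have : 0 ≤ 2 / κ * X := by positivity
      have : 0 ≤ K * Y := by positivity
      linarith
  set U := lyapunov a k r ε (z T) (m T) with hU
  set μ := c / N with hμ
  -- The Lyapunov function bounds `‖m‖²`, hence the square root and the halved rate.
  refine ⟨√(4 * U / l * Real.exp (μ * T)), μ / 2, T, by positivity, fun t ht e => ?_⟩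
  have h1 : ‖m t e‖ ^ 2 ≤ 4 * U / l * Real.exp (-(μ * (t - T))) := by
    have h2 := hdecay t ht
    obtain ⟨-, h3, -, -⟩ := hlyap t (hT t ht).2
    have h4 : ‖m t e‖ ^ 2 ≤ ∑ e, ‖m t e‖ ^ 2 :=
      Finset.single_le_sum (f := fun e => ‖m t e‖ ^ 2) (fun e _ => by positivity)
        (Finset.mem_univ e)
    have h5 := hcoer (m t)
    rw [flowEnergy] at h3
    have h6 := hpot t
    rw [div_mul_eq_mul_div, le_div_iff₀ hl]
    have h7 : ‖m t e‖ ^ 2 * l ≤ l * ∑ e, ‖m t e‖ ^ 2 := by rw [mul_comm]; gcongr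
    linarith
  have hUT : 0 ≤ U := by
    obtain ⟨-, h3, -, -⟩ := hlyap T (hT T le_rfl).2
    have h5 := hcoer (m T)
    have h6 := hpot T
    have h7 : 0 ≤ l * ∑ e, ‖m T e‖ ^ 2 := by positivity
    rw [flowEnergy] at h3
    linarith
  refine abs_le_of_sq_le_sq' ?_ (by positivity) |>.2
  rw [mul_pow, Real.sq_sqrt (by positivity), ← Real.exp_nat_mul, mul_assoc, ← Real.exp_add]
  rwa [show μ * T + (2 : ℕ) * -(μ / 2 * t) = -(μ * (t - T)) by push_cast; ring]

end IsSpringFlow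

section NetworkConvergence

open scoped RealInnerProductSpace

variable {V : Type*} [Fintype V] [DecidableEq V] {G : SimpleGraph V} [DecidableRel G.Adj] {n : ℕ}

/-! ### The incidence matrix of a tree -/

namespace EdgeOrientation

omit [Fintype V] [DecidableEq V] [DecidableRel G.Adj] in
theorem adj (o : EdgeOrientation G) (e : G.edgeSet) : G.Adj (o.tail e) (o.head e) := by
  rw [← SimpleGraph.mem_edgeSet, o.mk_tail_head]
  exact e.2

omit [DecidableRel G.Adj] in
theorem mixVec_transpose_incidence {W : Type*} [NormedAddCommGroup W] [InnerProductSpace ℝ W]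
    (o : EdgeOrientation G) (y : V → W) (e : G.edgeSet) :
    mixVec o.incidenceᵀ y e = y (o.head e) - y (o.tail e) := by
  have hne := (o.adj e).ne
  have h : ∀ i, o.incidenceᵀ e i • y i =
      (if i = o.head e then y i else 0) - (if i = o.tail e then y i else 0) := by
    intro i
    simp only [incidence, Matrix.transpose_apply, Matrix.of_apply]
    split_ifs with h1 h2
    · exact absurd (h2.symm.trans h1) hne
    · simp
    · simp
    · simp
  rw [mixVec, Finset.sum_congr rfl fun i _ => h i]
  simp

theorem sum_mixVec_incidence {W : Type*} [NormedAddCommGroup W] [InnerProductSpace ℝ W]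
    (o : EdgeOrientation G) (y : G.edgeSet → W) : ∑ i, mixVec o.incidence y i = 0 := by
  simp only [mixVec]
  rw [Finset.sum_comm]
  refine Finset.sum_eq_zero fun e _ => ?_
  rw [← Finset.sum_smul]
  have h := o.mixVec_transpose_incidence (fun _ => (1 : ℝ)) e
  simp only [mixVec, Matrix.transpose_apply, smul_eq_mul, mul_one, sub_self] at h
  rw [h, zero_smul]

/-- In a forest every edge is a bridge. Pairing `B y = 0` with the indicator of one side of the cut
made by deleting `e` leaves only the term of `e`, as every other edge has both ends on the same
side. -/
theorem mulVec_incidence_injective (o : EdgeOrientation G) (hG : G.IsAcyclic) :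
    Function.Injective o.incidence.mulVec := by
  classical
  rw [← Matrix.coe_mulVecLin, injective_iff_map_eq_zero]
  intro y hy
  funext e
  rw [Matrix.mulVecLin_apply] at hy
  set G' := G.deleteEdges {s(o.tail e, o.head e)} with hG'
  have hbridge : ¬ G'.Reachable (o.tail e) (o.head e) :=
    SimpleGraph.isBridge_iff.1 (SimpleGraph.isAcyclic_iff_forall_adj_isBridge.1 hG (o.adj e))
  set χ : V → ℝ := fun i => if G'.Reachable (o.tail e) i then 1 else 0 with hχ
  have h1 : ∑ i, χ i * (o.incidence *ᵥ y) i = 0 := by simp [hy]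
  have h2 : ∑ i, χ i * (o.incidence *ᵥ y) i = ∑ e', (χ (o.head e') - χ (o.tail e')) * y e' := by
    have h3 := sum_inner_mixVec o.incidence χ y
    simp only [mixVec_transpose_incidence] at h3
    simp only [mixVec, inner, smul_eq_mul] at h3
    simpa [Matrix.mulVec, dotProduct, mul_comm] using h3
  have h4 : ∀ e', e' ≠ e → χ (o.head e') - χ (o.tail e') = 0 := by
    intro e' he'
    have hadj : G'.Adj (o.tail e') (o.head e') := by
      rw [hG', SimpleGraph.deleteEdges_adj]
      refine ⟨o.adj e', fun h => he' ?_⟩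
      rw [Set.mem_singleton_iff, o.mk_tail_head, o.mk_tail_head] at h
      exact Subtype.ext h
    have hiff : G'.Reachable (o.tail e) (o.head e') ↔ G'.Reachable (o.tail e) (o.tail e') :=
      ⟨fun h => h.trans hadj.symm.reachable, fun h => h.trans hadj.reachable⟩
    simp [hχ, hiff]
  rw [h1, Finset.sum_eq_single e (fun e' _ he' => by rw [h4 e' he', zero_mul])
    (fun h => absurd (Finset.mem_univ e) h)] at h2
  simpa [hχ, hbridge] using h2.symm

theorem posDef_transpose_mul_incidence (o : EdgeOrientation G) (hG : G.IsAcyclic) :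
    (o.incidenceᵀ * o.incidence).PosDef := by
  have := Matrix.PosDef.conjTranspose_mul_self o.incidence (o.mulVec_incidence_injective hG)
  rwa [Matrix.conjTranspose_eq_transpose_of_trivial] at this

omit [DecidableRel G.Adj] in
theorem eq_zero_of_mixVec_transpose_incidence {W : Type*} [NormedAddCommGroup W]
    [InnerProductSpace ℝ W] (o : EdgeOrientation G) (hG : G.Connected) {y : V → W}
    (hy : ∀ e, mixVec o.incidenceᵀ y e = 0) (hsum : ∑ i, y i = 0) (i : V) : y i = 0 := by
  have hadj : ∀ u v, G.Adj u v → y u = y v := by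
    intro u v huv
    have he := hy ⟨s(u, v), huv⟩
    rw [mixVec_transpose_incidence, sub_eq_zero] at he
    have hmk := o.mk_tail_head ⟨s(u, v), huv⟩
    rcases Sym2.eq_iff.1 hmk with ⟨h1, h2⟩ | ⟨h1, h2⟩
    · rw [h1, h2] at he; exact he.symm
    · rw [h1, h2] at he; exact he
  have hconst : ∀ j, y j = y i := by
    intro j
    obtain ⟨p⟩ := hG.preconnected j i
    induction p with
    | nil => rfl
    | cons h _ ih => exact (hadj _ _ h).trans ih
  rw [Finset.sum_congr rfl fun j _ => hconst j, Finset.sum_const, Finset.card_univ,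
    ← Nat.cast_smul_eq_nsmul ℝ, smul_eq_zero] at hsum
  refine hsum.resolve_left ?_
  have : Nonempty V := ⟨i⟩
  exact_mod_cast Fintype.card_ne_zero

end EdgeOrientation

/-! ### The matrices of the collective dynamics, blockwise -/

/-- The `i`-th block of a vector with blocks of size `n`. -/
def block {I : Type*} (y : I × Fin n → ℝ) (i : I) : EuclideanSpace ℝ (Fin n) :=
  WithLp.toLp 2 fun b => y (i, b)

theorem kronecker_one_mulVec {I J : Type*} [Fintype J] (a : Matrix I J ℝ)
    (y : J × Fin n → ℝ) (i : I) :
    block ((a ⊗ₖ (1 : Matrix (Fin n) (Fin n) ℝ)) *ᵥ y) i = mixVec a (block y) i := by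
  ext b
  simp [block, mixVec, Matrix.mulVec, dotProduct, Fintype.sum_prod_type, Matrix.one_apply]

omit [DecidableRel G.Adj] in
theorem block_barB_mulVec (o : EdgeOrientation G) (y : V × Fin n → ℝ) (e : G.edgeSet) :
    block (o.barB n *ᵥ y) e = mixVec o.incidenceᵀ (block y) e :=
  kronecker_one_mulVec _ _ _

theorem block_transpose_barB_mulVec (o : EdgeOrientation G) (y : G.edgeSet × Fin n → ℝ) (i : V) :
    block ((o.barB n)ᵀ *ᵥ y) i = mixVec o.incidence (block y) i := by
  rw [EdgeOrientation.barB, ← Matrix.kroneckerMap_transpose,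
    Matrix.transpose_transpose, Matrix.transpose_one]
  exact kronecker_one_mulVec _ _ _

theorem block_damping_mulVec {E : Type*} [Fintype E] [DecidableEq E] (c : VirtualCouplings E n)
    (y : E × Fin n → ℝ) (e : E) :
    block (c.damping *ᵥ y) e = Matrix.toEuclideanCLM (𝕜 := ℝ) (c.D e) (block y e) := by
  ext b
  rw [Matrix.ofLp_toEuclideanCLM]
  simp [block, VirtualCouplings.damping, Matrix.mulVec, dotProduct, Fintype.sum_prod_type]

/-! ### The gradient of the Hamiltonian -/

/-- The linear map that extracts the momentum of an agent. -/
noncomputable def PHState.pCLM (i : V) : PHState G n →L[ℝ] EuclideanSpace ℝ (Fin n) :=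
  LinearMap.toContinuousLinearMap
    { toFun := fun ξ => PHState.p ξ i
      map_add' := fun _ _ => rfl
      map_smul' := fun _ _ => rfl }

/-- The state with the elongation `w` on the edge `e` and zero elsewhere. -/
def PHState.ofEdge (e : G.edgeSet) (w : EuclideanSpace ℝ (Fin n)) : PHState G n :=
  WithLp.toLp 2 (Sum.elim (fun b => if b.1 = e then w b.2 else 0) 0)

/-- The state with the momentum `w` at the agent `i` and zero elsewhere. -/
def PHState.ofAgent (i : V) (w : EuclideanSpace ℝ (Fin n)) : PHState G n :=
  WithLp.toLp 2 (Sum.elim 0 (fun b => if b.1 = i then w b.2 else 0))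

theorem PHState.inner_ofEdge (g : PHState G n) (e : G.edgeSet) (w : EuclideanSpace ℝ (Fin n)) :
    ⟪g, PHState.ofEdge e w⟫ = ⟪PHState.z g e, w⟫ := by
  simp [PHState.ofEdge, PHState.z, PiLp.inner_apply, Fintype.sum_prod_type, ite_mul]

theorem PHState.inner_ofAgent (g : PHState G n) (i : V) (w : EuclideanSpace ℝ (Fin n)) :
    ⟪g, PHState.ofAgent i w⟫ = ⟪PHState.p g i, w⟫ := by
  simp [PHState.ofAgent, PHState.p, PiLp.inner_apply, Fintype.sum_prod_type, ite_mul]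

theorem hamiltonian_add_ofEdge (c : VirtualCouplings G.edgeSet n) (ξ : PHState G n)
    (e : G.edgeSet) (w : EuclideanSpace ℝ (Fin n)) (s : ℝ) :
    hamiltonian c (ξ + s • PHState.ofEdge e w) = hamiltonian c ξ +
      (elasticEnergy (c.k e) (c.r e) (PHState.z ξ e + s • w) -
        elasticEnergy (c.k e) (c.r e) (PHState.z ξ e)) := by
  have hp : ∀ i, PHState.p (ξ + s • PHState.ofEdge e w) i = PHState.p ξ i := fun i => by
    ext b; simp [PHState.p, PHState.ofEdge]
  have hz : ∀ e', PHState.z (ξ + s • PHState.ofEdge e w) e' =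
      if e' = e then PHState.z ξ e + s • w else PHState.z ξ e' := fun e' => by
    ext b
    by_cases h : e' = e
    · subst h; simp [PHState.z, PHState.ofEdge]
    · simp [PHState.z, PHState.ofEdge, h]
  have hsum : ∑ e', c.springEnergy e' (PHState.z (ξ + s • PHState.ofEdge e w) e') =
      ∑ e', c.springEnergy e' (PHState.z ξ e') +
      (c.springEnergy e (PHState.z ξ e + s • w) - c.springEnergy e (PHState.z ξ e)) := by
    rw [← sub_eq_iff_eq_add', ← Finset.sum_sub_distrib, Finset.sum_eq_single e]
    · simp [hz]
    · intro e' _ he'; simp [hz, he']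
    · simp
  simp only [hamiltonian, hp, hsum]
  rw [add_assoc]
  rfl

theorem hamiltonian_add_ofAgent (c : VirtualCouplings G.edgeSet n) (ξ : PHState G n)
    (i : V) (w : EuclideanSpace ℝ (Fin n)) (s : ℝ) :
    hamiltonian c (ξ + s • PHState.ofAgent i w) = hamiltonian c ξ +
      (1 / 2 * ‖PHState.p ξ i + s • w‖ ^ 2 - 1 / 2 * ‖PHState.p ξ i‖ ^ 2) := by
  have hz : ∀ e, PHState.z (ξ + s • PHState.ofAgent i w) e = PHState.z ξ e := fun e => by
    ext b; simp [PHState.z, PHState.ofAgent]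
  have hp : ∀ j, PHState.p (ξ + s • PHState.ofAgent i w) j =
      if j = i then PHState.p ξ i + s • w else PHState.p ξ j := fun j => by
    ext b
    by_cases h : j = i
    · subst h; simp [PHState.p, PHState.ofAgent]
    · simp [PHState.p, PHState.ofAgent, h]
  have hsum : ∑ j, 1 / 2 * ‖PHState.p (ξ + s • PHState.ofAgent i w) j‖ ^ 2 =
      ∑ j, 1 / 2 * ‖PHState.p ξ j‖ ^ 2 +
      (1 / 2 * ‖PHState.p ξ i + s • w‖ ^ 2 - 1 / 2 * ‖PHState.p ξ i‖ ^ 2) := by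
    rw [← sub_eq_iff_eq_add', ← Finset.sum_sub_distrib, Finset.sum_eq_single i]
    · simp [hp]
    · intro j _ hj; simp [hp, hj]
    · simp
  simp only [hamiltonian, hz, hsum]
  ring

theorem HasGradientAt.hasDerivAt_add_smul {F : Type*} [NormedAddCommGroup F]
    [InnerProductSpace ℝ F] [CompleteSpace F] {f : F → ℝ} {g x : F} (h : HasGradientAt f g x)
    (d : F) : HasDerivAt (fun s : ℝ => f (x + s • d)) ⟪g, d⟫ 0 := by
  have := h.hasFDerivAt.hasLineDerivAt d
  simpa [HasLineDerivAt] using this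

theorem hasDerivAt_const_add_smul {F : Type*} [NormedAddCommGroup F] [NormedSpace ℝ F] (x w : F)
    (s : ℝ) : HasDerivAt (fun s : ℝ => x + s • w) w s := by
  simpa using ((hasDerivAt_id s).smul_const w).const_add x

theorem HasGradientAt.hamiltonian_p {c : VirtualCouplings G.edgeSet n} {g ξ : PHState G n}
    (h : HasGradientAt (hamiltonian c) g ξ) (i : V) : PHState.p g i = PHState.p ξ i := by
  refine ext_inner_right ℝ fun w => ?_
  have h1 := h.hasDerivAt_add_smul (PHState.ofAgent i w)
  simp only [hamiltonian_add_ofAgent, PHState.inner_ofAgent] at h1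
  have h2 := ((((hasDerivAt_const_add_smul (PHState.p ξ i) w 0).norm_sq.const_mul (1 / 2)).sub_const
    (1 / 2 * ‖PHState.p ξ i‖ ^ 2)).const_add (hamiltonian c ξ))
  have h3 := h1.unique h2
  rw [h3]
  simp

theorem HasGradientAt.hamiltonian_smooth (hn : 0 < n) {c : VirtualCouplings G.edgeSet n}
    {g ξ : PHState G n} (h : HasGradientAt (hamiltonian c) g ξ) (e : G.edgeSet) :
    PHState.z ξ e ≠ 0 ∨ c.r e = 0 := by
  by_contra hcon
  push Not at hcon
  obtain ⟨hz, hr⟩ := hcon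
  set w : EuclideanSpace ℝ (Fin n) := EuclideanSpace.single ⟨0, hn⟩ 1 with hw
  have hw1 : ‖w‖ = 1 := by simp [hw]
  have h1 := (h.hasDerivAt_add_smul (PHState.ofEdge e w)).differentiableAt
  simp only [hamiltonian_add_ofEdge, hz, zero_add, elasticEnergy, norm_smul, hw1, mul_one,
    Real.norm_eq_abs] at h1
  refine not_differentiableAt_abs_zero ?_
  have hk := (c.k_pos e).ne'
  have h2 : DifferentiableAt ℝ (fun s : ℝ => s ^ 2) 0 := by fun_prop
  -- Along a unit direction the energy is `½ k (|s| - r)²`; solving for `|s|`, possible as `k r ≠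
  -- 0`, would make `|s|` differentiable at `0`.
  have h3 := (((h1.sub_const (hamiltonian c ξ)).add_const
    (1 / 2 * c.k e * (‖(0 : EuclideanSpace ℝ (Fin n))‖ - c.r e) ^ 2)).const_mul
      (-(c.k e * c.r e)⁻¹)).add ((h2.const_mul (2 * c.r e)⁻¹).add_const (c.r e / 2))
  refine h3.congr_of_eventuallyEq (Eventually.of_forall fun s => ?_)
  simp only [Pi.add_apply]
  rw [← sq_abs s]
  field_simp
  ring

theorem HasGradientAt.hamiltonian_z (hn : 0 < n) {c : VirtualCouplings G.edgeSet n}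
    {g ξ : PHState G n} (h : HasGradientAt (hamiltonian c) g ξ) (e : G.edgeSet) :
    PHState.z g e = elasticForce (c.k e) (c.r e) (PHState.z ξ e) := by
  refine ext_inner_right ℝ fun w => ?_
  have h1 := h.hasDerivAt_add_smul (PHState.ofEdge e w)
  simp only [hamiltonian_add_ofEdge, PHState.inner_ofEdge] at h1
  have h2 := (((hasDerivAt_const_add_smul (PHState.z ξ e) w 0).elasticEnergy (k := c.k e) (r := c.r e)
    (by simpa using h.hamiltonian_smooth hn e)).sub_const
    (elasticEnergy (c.k e) (c.r e) (PHState.z ξ e))).const_add (hamiltonian c ξ)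
  have h3 := h1.unique h2
  rw [h3]
  simp

/-! ### The collective dynamics as a spring flow -/

theorem PHState.z_toPHState (o : EdgeOrientation G) (x : V → AgentVar n) (e : G.edgeSet) :
    PHState.z (toPHState o x) e = mixVec o.incidenceᵀ (fun i => (x i).1) e :=
  block_barB_mulVec o _ e

theorem PHState.p_toPHState (o : EdgeOrientation G) (x : V → AgentVar n) (i : V) :
    PHState.p (toPHState o x) i = (x i).2 := rfl

theorem PHState.p_collectiveMatrix (o : EdgeOrientation G) (c : VirtualCouplings G.edgeSet n)
    (g : PHState G n) (i : V) :
    PHState.p (WithLp.toLp 2 (-(collectiveMatrix o c *ᵥ g.ofLp)) : PHState G n) i =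
      -mixVec o.incidence (fun e => PHState.z g e + Matrix.toEuclideanCLM (𝕜 := ℝ) (c.D e)
        (mixVec o.incidenceᵀ (PHState.p g) e)) i := by
  have hz : PHState.z g = block (g.ofLp ∘ Sum.inl) := rfl
  have hp : PHState.p g = block (g.ofLp ∘ Sum.inr) := rfl
  have h : (fun e => PHState.z g e + Matrix.toEuclideanCLM (𝕜 := ℝ) (c.D e)
        (mixVec o.incidenceᵀ (PHState.p g) e)) =
      block (g.ofLp ∘ Sum.inl + c.damping *ᵥ (o.barB n *ᵥ (g.ofLp ∘ Sum.inr))) := by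
    funext e
    rw [hp, ← block_barB_mulVec, ← block_damping_mulVec, hz]
    rfl
  rw [h, ← block_transpose_barB_mulVec]
  ext b
  simp [PHState.p, block, collectiveMatrix, Matrix.fromBlocks_mulVec, Matrix.mulVec_add,
    Matrix.mulVec_mulVec, Matrix.mul_assoc]

variable {o : EdgeOrientation G} {c : VirtualCouplings G.edgeSet n} {x : ℝ → V → AgentVar n}

theorem IsAgentTrajectory.hasDerivWithinAt_velocity (hn : 0 < n) (hx : IsAgentTrajectory o c x)
    {t : ℝ} (ht : 0 ≤ t) (i : V) :
    HasDerivWithinAt (fun s => (x s i).2)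
      (-mixVec o.incidence (fun e => elasticForce (c.k e) (c.r e) (PHState.z (toPHState o (x t)) e)
        + Matrix.toEuclideanCLM (𝕜 := ℝ) (c.D e)
          (mixVec o.incidenceᵀ (fun i => (x t i).2) e)) i) (Set.Ici 0) t := by
  obtain ⟨g, hg, hd⟩ := hx.2 t ht
  have h1 := (PHState.pCLM i).hasFDerivAt.comp_hasDerivWithinAt t hd
  refine h1.congr_deriv ?_
  change PHState.p (WithLp.toLp 2 (-(collectiveMatrix o c *ᵥ g.ofLp)) : PHState G n) i = _
  have hp : PHState.p g = fun i => (x t i).2 := funext fun i => hg.hamiltonian_p i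
  simp only [PHState.p_collectiveMatrix, hp, hg.hamiltonian_z hn]

/-- The edge momentum is the least-squares solution of `B m = p`. Only `a m = Bᵀ p` and `a⁻¹ Bᵀ B =
1` are needed, so the reduction holds for any total momentum. -/
theorem IsAgentTrajectory.isSpringFlow (hn : 0 < n) (hG : G.IsAcyclic)
    (hx : IsAgentTrajectory o c x) :
    IsSpringFlow (o.incidenceᵀ * o.incidence) c.k c.r
      (fun e => Matrix.toEuclideanCLM (𝕜 := ℝ) (c.D e))
      (fun t => PHState.z (toPHState o (x t)))
      (fun t => mixVec ((o.incidenceᵀ * o.incidence)⁻¹ * o.incidenceᵀ) fun i => (x t i).2) := by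
  have hpos := o.posDef_transpose_mul_incidence hG
  set a := o.incidenceᵀ * o.incidence with ha
  have hdet : IsUnit a.det := (Matrix.isUnit_iff_isUnit_det _).mp hpos.isUnit
  have hv : ∀ t e, mixVec a (mixVec (a⁻¹ * o.incidenceᵀ) fun i => (x t i).2) e =
      mixVec o.incidenceᵀ (fun i => (x t i).2) e := fun t e => by
    rw [← mixVec_mul, ← Matrix.mul_assoc, Matrix.mul_nonsing_inv _ hdet, Matrix.one_mul]
  refine ⟨hpos, c.k_pos, c.r_nonneg, fun e => ?_, fun t ht e => ?_, fun t ht e => ?_,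
    fun t ht e => ?_⟩
  · obtain ⟨l, hl, h⟩ := (c.D_posDef e).exists_coercive (W := ℝ)
    refine ⟨l, hl, fun v => ?_⟩
    have := h v.ofLp
    rw [EuclideanSpace.norm_sq_eq]
    refine this.trans (le_of_eq ?_)
    rw [PiLp.inner_apply]
    refine Finset.sum_congr rfl fun b _ => ?_
    rw [Matrix.ofLp_toEuclideanCLM, real_inner_comm]
    rfl
  · rw [hv]
    simp only [PHState.z_toPHState]
    exact HasDerivAt.mixVec _ (fun i => (hx.1 t ht.le i).hasDerivAt (Ici_mem_nhds ht)) e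
  · refine (HasDerivAt.mixVec _ (fun i => (hx.hasDerivWithinAt_velocity hn ht.le i).hasDerivAt
      (Ici_mem_nhds ht)) e).congr_deriv ?_
    simp only [hv]
    have hneg : ∀ y : V → EuclideanSpace ℝ (Fin n), mixVec (a⁻¹ * o.incidenceᵀ)
        (fun i => - y i) e = - mixVec (a⁻¹ * o.incidenceᵀ) y e := fun y => by simp [mixVec]
    rw [hneg, ← mixVec_mul, Matrix.mul_assoc, Matrix.nonsing_inv_mul _ hdet, mixVec_one]
  · obtain ⟨g, hg, -⟩ := hx.2 t ht.le
    exact hg.hamiltonian_smooth hn e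

/-! ### Convergence of the motion -/

theorem eq_of_hasDerivWithinAt_Ici_zero {F : Type*} [NormedAddCommGroup F] [NormedSpace ℝ F]
    {f : ℝ → F} (h : ∀ t ≥ 0, HasDerivWithinAt f 0 (Set.Ici 0) t) {t : ℝ} (ht : 0 ≤ t) :
    f t = f 0 := by
  have := Convex.norm_image_sub_le_of_norm_hasDerivWithin_le (C := 0) h (by simp)
    (convex_Ici 0) (Set.mem_Ici.2 le_rfl) (Set.mem_Ici.2 ht)
  rw [zero_mul, norm_le_zero_iff, sub_eq_zero] at this
  exact this

/-- All forces are internal: the columns of `B` sum to zero. -/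
theorem IsAgentTrajectory.sum_velocity_eq (hn : 0 < n) (hx : IsAgentTrajectory o c x) {t : ℝ}
    (ht : 0 ≤ t) : ∑ i, (x t i).2 = ∑ i, (x 0 i).2 := by
  refine eq_of_hasDerivWithinAt_Ici_zero (f := fun t => ∑ i, (x t i).2) (fun s hs => ?_) ht
  refine (HasDerivWithinAt.fun_sum fun i _ =>
    hx.hasDerivWithinAt_velocity hn hs i).congr_deriv ?_
  rw [Finset.sum_neg_distrib, o.sum_mixVec_incidence, neg_zero]

theorem IsAgentTrajectory.sum_position_eq (hn : 0 < n) (hx : IsAgentTrajectory o c x) {t : ℝ}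
    (ht : 0 ≤ t) : ∑ i, (x t i).1 - t • ∑ i, (x 0 i).2 = ∑ i, (x 0 i).1 := by
  have := eq_of_hasDerivWithinAt_Ici_zero
    (f := fun t => ∑ i, (x t i).1 - t • ∑ i, (x 0 i).2) (fun s hs => ?_) ht
  · simpa using this
  · have h1 := (HasDerivWithinAt.fun_sum fun i (_ : i ∈ Finset.univ) => hx.1 s hs i).sub
      ((hasDerivWithinAt_id s (Set.Ici 0)).smul_const (∑ i, (x 0 i).2))
    refine h1.congr_deriv ?_
    rw [hx.sum_velocity_eq hn hs, one_smul, sub_self]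

theorem IsAgentTrajectory.sum_velocity_eq_zero_of_isCompact (hn : 0 < n)
    (hx : IsAgentTrajectory o c x) {X : V → Set (AgentVar n)} (hX : ∀ i, IsCompact (X i))
    (hmem : ∀ t, 0 ≤ t → ∀ i, x t i ∈ X i) : ∑ i, (x 0 i).2 = 0 := by
  have hbd : ∀ i, ∃ R, ∀ y ∈ X i, ‖y‖ ≤ R := fun i => (hX i).isBounded.exists_norm_le
  choose R hR using hbd
  by_contra hne
  have hpos : 0 < ‖∑ i, (x 0 i).2‖ := norm_pos_iff.2 hne
  have hsum : ∀ t ≥ 0, ‖∑ i, (x t i).1‖ ≤ ∑ i, R i := fun t ht =>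
    (norm_sum_le _ _).trans (Finset.sum_le_sum fun i _ =>
      (norm_fst_le _).trans (hR i _ (hmem t ht i)))
  have hR0 : 0 ≤ ∑ i, R i := (norm_nonneg _).trans (hsum 0 le_rfl)
  -- By this time the sum of the positions has moved by `2 ∑ R i + 1`, more than the diameter
  -- allowed by the bounds.
  set t := (2 * ∑ i, R i + 1) / ‖∑ i, (x 0 i).2‖ with ht
  have ht0 : 0 ≤ t := by positivity
  have h1 : t • ∑ i, (x 0 i).2 = ∑ i, (x t i).1 - ∑ i, (x 0 i).1 := by
    rw [← hx.sum_position_eq hn ht0]; abel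
  have h2 : ‖t • ∑ i, (x 0 i).2‖ = 2 * ∑ i, R i + 1 := by
    rw [norm_smul, Real.norm_of_nonneg ht0, ht, div_mul_cancel₀ _ hpos.ne']
  rw [h1] at h2
  have h3 := norm_sub_le (∑ i, (x t i).1) (∑ i, (x 0 i).1)
  linarith [hsum t ht0, hsum 0 le_rfl]

theorem exists_tendsto_of_hasDerivAt_of_norm_le_exp {F : Type*} [NormedAddCommGroup F]
    [NormedSpace ℝ F] [CompleteSpace F] {f f' : ℝ → F} {C μ T : ℝ} (hμ : 0 < μ)
    (hf : ∀ t ≥ T, HasDerivAt f (f' t) t) (hf' : ContinuousOn f' (Set.Ici T))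
    (hle : ∀ t ≥ T, ‖f' t‖ ≤ C * Real.exp (-(μ * t))) : ∃ l, Tendsto f atTop (𝓝 l) := by
  refine ⟨_, MeasureTheory.tendsto_limUnder_of_hasDerivAt_of_integrableOn_Ioi (a := T) (f' := f')
    (fun t ht => hf t (Set.mem_Ioi.1 ht).le) ?_⟩
  have hint : MeasureTheory.IntegrableOn (fun t => C * Real.exp (-(μ * t))) (Set.Ioi T) := by
    have := (exp_neg_integrableOn_Ioi T hμ).const_mul C
    simp only [neg_mul] at this
    exact this
  refine MeasureTheory.Integrable.mono' hint
    ((hf'.mono Set.Ioi_subset_Ici_self).aestronglyMeasurable measurableSet_Ioi) ?_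
  filter_upwards [MeasureTheory.ae_restrict_mem measurableSet_Ioi] with t ht
    using hle t (Set.mem_Ioi.1 ht).le

theorem IsAgentTrajectory.exists_tendsto (hn : 0 < n) (hconn : G.Connected) (hG : G.IsAcyclic)
    (hx : IsAgentTrajectory o c x) (h0 : ∑ i, (x 0 i).2 = 0) :
    ∃ xbar : V → AgentVar n, Tendsto x atTop (𝓝 xbar) ∧ (∀ i, (xbar i).2 = 0) ∧
      ∀ e, ‖PHState.z (toPHState o xbar) e‖ = c.r e := by
  have hflow := hx.isSpringFlow hn hG
  set a := o.incidenceᵀ * o.incidence with ha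
  set m : ℝ → G.edgeSet → EuclideanSpace ℝ (Fin n) :=
    fun t => mixVec (a⁻¹ * o.incidenceᵀ) fun i => (x t i).2 with hm
  have hdet : IsUnit a.det := (Matrix.isUnit_iff_isUnit_det _).mp hflow.posDef.isUnit
  -- The difference `p - B m` is killed by `Bᵀ`, hence constant on the connected graph, and it sums
  -- to zero because the total momentum does.
  have hp : ∀ t ≥ 0, ∀ i, (x t i).2 = mixVec o.incidence (m t) i := by
    intro t ht i
    refine sub_eq_zero.1 (o.eq_zero_of_mixVec_transpose_incidence hconn
      (y := fun i => (x t i).2 - mixVec o.incidence (m t) i) (fun e => ?_) ?_ i)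
    · have hsub : ∀ y y' : V → EuclideanSpace ℝ (Fin n), mixVec o.incidenceᵀ
          (fun i => y i - y' i) e = mixVec o.incidenceᵀ y e - mixVec o.incidenceᵀ y' e :=
        fun y y' => by simp [mixVec, smul_sub]
      rw [hsub, sub_eq_zero, hm]
      simp only
      rw [← mixVec_mul, ← mixVec_mul, ← ha, ← Matrix.mul_assoc, Matrix.mul_nonsing_inv _ hdet,
        Matrix.one_mul]
    · rw [Finset.sum_sub_distrib, hx.sum_velocity_eq hn ht, h0, o.sum_mixVec_incidence, sub_zero]
  have hp0 : ∀ i, Tendsto (fun t => (x t i).2) atTop (𝓝 0) := by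
    intro i
    have h1 := Filter.Tendsto.mixVec o.incidence hflow.tendsto_zero.1 i
    rw [mixVec_zero] at h1
    refine h1.congr' ?_
    filter_upwards [eventually_ge_atTop 0] with t ht using (hp t ht i).symm
  obtain ⟨C, μ, T, hμ, hexp⟩ := hflow.exists_norm_le_exp
  have hq : ∀ i, ∃ q, Tendsto (fun t => (x t i).1) atTop (𝓝 q) := by
    intro i
    refine exists_tendsto_of_hasDerivAt_of_norm_le_exp (T := max T 1)
      (C := ∑ e, |o.incidence i e| * C) hμ (f' := fun t => (x t i).2)
      (fun t ht => ?_) (fun t ht => ?_) fun t ht => ?_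
    · have ht0 : 0 < t := zero_lt_one.trans_le ((le_max_right _ _).trans ht)
      exact (hx.1 t ht0.le i).hasDerivAt (Ici_mem_nhds ht0)
    · have ht0 : 0 < t := zero_lt_one.trans_le ((le_max_right _ _).trans ht)
      exact ((hx.hasDerivWithinAt_velocity hn ht0.le i).hasDerivAt
        (Ici_mem_nhds ht0)).continuousAt.continuousWithinAt
    · have ht0 : 0 < t := zero_lt_one.trans_le ((le_max_right _ _).trans ht)
      rw [hp t ht0.le i, mixVec, Finset.sum_mul]
      refine (norm_sum_le _ _).trans (Finset.sum_le_sum fun e _ => ?_)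
      rw [norm_smul, Real.norm_eq_abs, mul_assoc]
      exact mul_le_mul_of_nonneg_left (hexp t ((le_max_left _ _).trans ht) e) (abs_nonneg _)
  choose q hq using hq
  refine ⟨fun i => (q i, 0), tendsto_pi_nhds.2 fun i => (hq i).prodMk_nhds (hp0 i),
    fun _ => rfl, fun e => ?_⟩
  rw [PHState.z_toPHState]
  have h1 := (Filter.Tendsto.mixVec o.incidenceᵀ hq e).norm
  refine tendsto_nhds_unique h1 ?_
  simpa only [PHState.z_toPHState] using hflow.tendsto_norm e

/-! ### The game -/

theorem VirtualCouplings.springEnergy_nonneg {E : Type*} (c : VirtualCouplings E n) (e : E)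
    (z : EuclideanSpace ℝ (Fin n)) : 0 ≤ c.springEnergy e z :=
  elasticEnergy_nonneg (c.k_pos e) z

omit [DecidableEq V] in
theorem hamiltonian_nonneg (c : VirtualCouplings G.edgeSet n) (ξ : PHState G n) :
    0 ≤ hamiltonian c ξ :=
  add_nonneg (Finset.sum_nonneg fun _ _ => by positivity)
    (Finset.sum_nonneg fun _ _ => c.springEnergy_nonneg _ _)

theorem hamiltonian_eq_zero {y : V → AgentVar n} (hy : ∀ i, (y i).2 = 0)
    (hz : ∀ e, ‖PHState.z (toPHState o y) e‖ = c.r e) : hamiltonian c (toPHState o y) = 0 := by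
  simp [hamiltonian, VirtualCouplings.springEnergy, hz, PHState.p_toPHState, hy]

/-- Every objective is a sum of nonnegative terms and vanishes at `y`, so no deviation can improve
it, whatever the feasible sets are. -/
theorem networkGame_isNashEquilibrium {y : V → AgentVar n} (hy : ∀ i, (y i).2 = 0)
    (hz : ∀ e, ‖PHState.z (toPHState o y) e‖ = c.r e) {Y : V → Set (AgentVar n)}
    (hY : ∀ i, y i ∈ Y i) : (networkGame o c Y).IsNashEquilibrium y := by
  refine ⟨hY, fun i w _ => ?_⟩
  have h0 : (networkGame o c Y).J i y = 0 := by
    simp [networkGame, VirtualCouplings.springEnergy, hz, hy]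
  rw [h0]
  exact add_nonneg (by positivity) (Finset.sum_nonneg fun e _ => c.springEnergy_nonneg _ _)

theorem networkGame_isExactPotential (o : EdgeOrientation G) (c : VirtualCouplings G.edgeSet n)
    (X : V → Set (AgentVar n)) :
    (networkGame o c X).IsExactPotential (fun y => hamiltonian c (toPHState o y)) := by
  intro x _ i y _ y' _
  -- What `J_i` omits from `H` is the kinetic energy of the other agents and the springs not
  -- incident to `i`; neither depends on the strategy `w` of `i`.
  have key : ∀ w, hamiltonian c (toPHState o (Function.update x i w)) -
      (networkGame o c X).J i (Function.update x i w) =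
      ∑ j ∈ Finset.univ.erase i, 1 / 2 * ‖(x j).2‖ ^ 2 +
        ∑ e with ¬ o.incidence i e ≠ 0, c.springEnergy e (PHState.z (toPHState o x) e) := by
    intro w
    have hkin : ∑ j, 1 / 2 * ‖(Function.update x i w j).2‖ ^ 2 =
        1 / 2 * ‖(Function.update x i w i).2‖ ^ 2 +
          ∑ j ∈ Finset.univ.erase i, 1 / 2 * ‖(x j).2‖ ^ 2 := by
      rw [← Finset.add_sum_erase _ _ (Finset.mem_univ i)]
      congr 1
      refine Finset.sum_congr rfl fun j hj => ?_
      rw [Function.update_of_ne (Finset.ne_of_mem_erase hj)]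
    have hpot : ∑ e with ¬ o.incidence i e ≠ 0,
        c.springEnergy e (PHState.z (toPHState o (Function.update x i w)) e) =
        ∑ e with ¬ o.incidence i e ≠ 0, c.springEnergy e (PHState.z (toPHState o x) e) := by
      refine Finset.sum_congr rfl fun e he => ?_
      have hie : o.incidence i e = 0 := not_not.1 (Finset.mem_filter.1 he).2
      rw [PHState.z_toPHState, PHState.z_toPHState]
      congr 1
      refine Finset.sum_congr rfl fun j _ => ?_
      by_cases hj : j = i
      · rw [hj, Matrix.transpose_apply, hie, zero_smul, zero_smul]
      · simp only [Function.update_of_ne hj]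
    simp only [hamiltonian, networkGame, PHState.p_toPHState]
    rw [hkin, ← hpot, ← Finset.sum_filter_add_sum_filter_not Finset.univ
      (fun e => o.incidence i e ≠ 0)]
    ring
  have h1 := key y
  have h2 := key y'
  simp only
  linarith

end NetworkConvergence

theorem mainTheorem5 {N n : ℕ} (hn : 0 < n)
    (G : SimpleGraph (Fin N)) [DecidableRel G.Adj] (hconn : G.Connected) (hacyc : G.IsAcyclic)
    (o : EdgeOrientation G) (c : VirtualCouplings G.edgeSet n)
    (X : Fin N → Set (AgentVar n)) (hXcompact : ∀ i, IsCompact (X i))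
    (hXconvex : ∀ i, Convex ℝ (X i))
    (x : ℝ → Fin N → AgentVar n) (hx : IsAgentTrajectory o c x) :
    (networkGame o c X).IsExactPotential (fun y => hamiltonian c (toPHState o y)) ∧
    ((∀ t, 0 ≤ t → ∀ i, x t i ∈ X i) →
      ∃ xbar : Fin N → AgentVar n, Tendsto x atTop (𝓝 xbar) ∧
        (networkGame o c X).IsNashEquilibrium xbar ∧
        (∀ e, ‖PHState.z (toPHState o xbar) e‖ = c.r e) ∧
        (∀ ξ : PHState G n, hamiltonian c (toPHState o xbar) ≤ hamiltonian c ξ)) ∧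
    (∑ i, (x 0 i).2 = 0 →
      ∃ xbar : Fin N → AgentVar n, Tendsto x atTop (𝓝 xbar) ∧
        (∀ Y : Fin N → Set (AgentVar n), (∀ i, xbar i ∈ Y i) →
          (networkGame o c Y).IsNashEquilibrium xbar) ∧
        (∀ e, ‖PHState.z (toPHState o xbar) e‖ = c.r e) ∧
        (∀ ξ : PHState G n, hamiltonian c (toPHState o xbar) ≤ hamiltonian c ξ)) := by
  refine ⟨networkGame_isExactPotential o c X, fun hmem => ?_, fun h0 => ?_⟩
  · obtain ⟨xbar, hlim, hp, hz⟩ := hx.exists_tendsto hn hconn hacyc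
      (hx.sum_velocity_eq_zero_of_isCompact hn hXcompact hmem)
    refine ⟨xbar, hlim, networkGame_isNashEquilibrium hp hz fun i => ?_, hz, fun ξ => ?_⟩
    · refine (hXcompact i).isClosed.mem_of_tendsto (tendsto_pi_nhds.1 hlim i) ?_
      filter_upwards [eventually_ge_atTop 0] with t ht using hmem t ht i
    · rw [hamiltonian_eq_zero hp hz]
      exact hamiltonian_nonneg c ξ
  · obtain ⟨xbar, hlim, hp, hz⟩ := hx.exists_tendsto hn hconn hacyc h0
    refine ⟨xbar, hlim, fun Y hY => networkGame_isNashEquilibrium hp hz hY, hz, fun ξ => ?_⟩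
    rw [hamiltonian_eq_zero hp hz]
    exact hamiltonian_nonneg c ξ
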